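/- **Setting.** A *point-line problem in three views* consists of $p$ points and $l$ lines in space, an incidence relation $\mathcal I\subset\{1,\dots,p\}\times\{1,\dots,l\}$, and for each view $v\in\{1,2,3\}$ the sets $\mathcal P_v\subset\{1,\dots,p\}$ and $\mathcal L_v\subset\{1,\dots,l\}$ of points and lines observed in it. One assumes that $\mathcal I$ is realizable by distinct points and distinct lines in $\mathbb R^3$, that $\mathcal I$ contains every incidence implied by those in $\mathcal I$, and that a view which observes two lines meeting according to $\mathcal I$ also observes their point of intersection. The problem is a *PL$_1$P* if each line is incident to at most one point. A line incident to a point is a *pin* of that point; a line incident to no point is *free*; a pin is *dangling* if it is observed in exactly one view. All varieties are taken over $\mathbb C$. Let $\mathcal X$ be the variety of all $(X,L)\in(\mathbb P^3)^p\times(\mathbb G_{1,3})^l$ with $X_i\in L_j$ for all $(i,j)\in\mathcal I$. Let $\mathcal C$ be the variety of triples of calibrated cameras $P_v=[R_v\mid t_v]$ with $R_v\in\mathrm{SO}(3)$, $R_1=I$, $t_1=0$ and first coordinate of $t_2$ equal to $1$. Let $\mathcal Y$ be the variety of all tuples of image points $x_{v,i}\in\mathbb P^2$ ($i\in\mathcal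 P_v$) and image lines $\ell_{v,j}\in\mathbb G_{1,2}$ ($j\in\mathcal L_v$) with $x_{v,i}\in\ell_{v,j}$ whenever $(i,j)\in\mathcal I$. The joint camera map $\Phi:\mathcal X\times\mathcal C\dashrightarrow\mathcal Y$ projects the observed points and lines into the views. The problem is *camera-minimal* if, for generic $y\in\mathcal Y$, the fibre $\Phi^{-1}(y)$ is non-empty and its projection to $\mathcal C$ is finite. Forgetting some points and lines, in space and in all views, gives a problem with joint camera map $\Phi':\mathcal X'\times\mathcal C\dashrightarrow\mathcal Y'$, and forgetting maps $\Pi:\mathcal X\times\mathcal C\to\mathcal X'\times\mathcal C$ and $\pi:\mathcal Y\to\mathcal Y'$. The problem is *reducible* to the new one if (i) for each forgotten point at most one of its pins is kept, and (ii) for generic $S'=((X',L'),P)\in\mathcal X'\times\mathcal C$ and generic $y\in\pi^{-1}(\Phi'(S'))$ there is $(X,L)\in\mathcal X$ with $\Phi((X,L),P)=y$ and $\Pi((X,L),P)=S'$. It is *reduced* if it is not reducible to any problem obtained by forgetting at least one point or line. **Theorem.** Consider a reduced camera-minimal PL$_1$P in three views. There is at most one point with three or more pins. If there is one, it has at most seven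 pins, and the point and all its pins are observed in all three views. All other local features are observed in one of the following ways, where $\{u,v,w\}=\{1,2,3\}$ in some order. * A point with two pins: either - the point and both pins are observed in all three views; or - the point is observed exactly in $u$, one pin exactly in $u,v$, and the other pin exactly in $u,w$; or - (both pins dangling) the point is observed exactly in $u$, one pin exactly in $v$, and the other pin exactly in $w$; or - (one pin dangling) the point is observed exactly in $u$, one pin exactly in $v$, and the other pin exactly in $u,w$. * A point with one pin: either - the point and the pin are observed in all three views; or - the point is observed exactly in $u,v$ and the pin in all three views; or - the point is observed exactly in $u,v$ and the pin exactly in $v,w$; or - the point is observed exactly in $u$ and the pin exactly in $v,w$; or - (the pin is dangling) the point is observed exactly in $u,v$ and the pin exactly in $w$. * A point without pins is observed in all three views or in exactly two. * A free line is observed in all three views. -/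

import Mathlib

namespace PointLine

/-- The three views. -/
abbrev View := Fin 3

/-! ### Point-line problems in three views -/

section Problems

variable {ι κ : Type}

/-- Pairwise distinct points `X i` and pairwise distinct lines `L j` in `ℝ³` which satisfy all the
incidences in `inc`. -/
def IsRealization (inc : Set (ι × κ)) (X : ι → (Fin 3 → ℝ))
    (L : κ → AffineSubspace ℝ (Fin 3 → ℝ)) : Prop :=
  Function.Injective X ∧ Function.Injective L ∧
    (∀ j, Module.finrank ℝ (L j).direction = 1) ∧ ∀ i j, (i, j) ∈ inc → X i ∈ L j

end Problems

/-- A point-line problem in three views, with points labelled by `ι` and lines labelled by `κ`. -/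
structure PointLineProblem (ι κ : Type) where
  /-- `(i, j) ∈ inc` means that the point `i` is on the line `j`. -/
  inc : Set (ι × κ)
  /-- the points observed in each view -/
  obsPt : View → Set ι
  /-- the lines observed in each view -/
  obsLn : View → Set κ
  /-- the incidences can be realized by an arrangement in `ℝ³` -/
  realizable : ∃ X L, IsRealization inc X L
  /-- an incidence which is implied by those in `inc` belongs to `inc` -/
  complete : ∀ i j, (∀ X L, IsRealization inc X L → X i ∈ L j) → (i, j) ∈ inc
  /-- a view which observes two lines that meet observes their point of intersection -/
  obs_meet : ∀ v i j j', j ≠ j' → (i, j) ∈ inc → (i, j') ∈ inc →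
    j ∈ obsLn v → j' ∈ obsLn v → i ∈ obsPt v

namespace PointLineProblem

variable {ι κ : Type} (Q : PointLineProblem ι κ)

/-- Each line in space is incident to at most one point. -/
def IsPL1P : Prop := ∀ j, {i | (i, j) ∈ Q.inc}.Subsingleton

/-- The pins of a point: the lines incident to it. -/
def pins (i : ι) : Set κ := {j | (i, j) ∈ Q.inc}

/-- A free line is incident to no point. -/
def IsFreeLine (j : κ) : Prop := ∀ i, (i, j) ∉ Q.inc

/-- The views which observe the point `i`. -/
def viewsPt (i : ι) : Set View := {v | i ∈ Q.obsPt v}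

/-- The views which observe the line `j`. -/
def viewsLn (j : κ) : Set View := {v | j ∈ Q.obsLn v}

/-- The problem obtained by keeping only the points in `S` and the lines in `T`, in space and in
the views. -/
def restrict (S : Set ι) (T : Set κ) : PointLineProblem S T where
  inc := {ij | ((ij.1 : ι), (ij.2 : κ)) ∈ Q.inc}
  obsPt v := {i | (i : ι) ∈ Q.obsPt v}
  obsLn v := {j | (j : κ) ∈ Q.obsLn v}
  realizable := by
    obtain ⟨X, L, hX, hL, h1, h⟩ := Q.realizable
    exact ⟨fun i => X i, fun j => L j, hX.comp Subtype.val_injective,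
      hL.comp Subtype.val_injective, fun j => h1 j, fun i j hij => h i j hij⟩
  complete i j hij := Q.complete i j fun X L ⟨hX, hL, h1, h⟩ =>
    hij (fun i => X i) (fun j => L j) ⟨hX.comp Subtype.val_injective,
      hL.comp Subtype.val_injective, fun j => h1 j, fun i j hij => h i j hij⟩
  obs_meet v i j j' hne hj hj' hv hv' :=
    Q.obs_meet v i j j' (fun h => hne (Subtype.ext h)) hj hj' hv hv'

end PointLineProblem

/-! ### Arrangements, cameras, joint images

The varieties are taken over `ℂ`. Points and lines of `ℙⁿ⁻¹` are the linear subspaces of `ℂⁿ` of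
dimension one and two. -/

/-- The Grassmannian of `k`-dimensional linear subspaces of `ℂⁿ`. -/
abbrev Grass (k n : ℕ) : Type :=
  {W : Submodule ℂ (Fin n → ℂ) // Module.finrank ℂ W = k}

/-- Points and lines in `ℙ³`. -/
structure Arrangement (ι κ : Type) where
  pt : ι → Grass 1 4
  ln : κ → Grass 2 4

/-- Forget the points outside `S` and the lines outside `T`. -/
def Arrangement.restrict {ι κ : Type} (A : Arrangement ι κ) (S : Set ι) (T : Set κ) :
    Arrangement S T where
  pt i := A.pt i
  ln j := A.ln j

/-- Three projective cameras, given by their `3 × 4` matrices. -/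
abbrev Cameras : Type := View → Matrix (Fin 3) (Fin 4) ℂ

/-- The block `R` of `[R | t]`. -/
def rot (P : Matrix (Fin 3) (Fin 4) ℂ) : Matrix (Fin 3) (Fin 3) ℂ := P.submatrix id Fin.castSucc

/-- The column `t` of `[R | t]`. -/
def transl (P : Matrix (Fin 3) (Fin 4) ℂ) : Fin 3 → ℂ := fun a => P a 3

/-- The camera configurations: `P v = [R v | t v]` with `R v` in `SO(3)`, where `R = 1` and `t = 0`
for the first camera and the first coordinate of `t` is `1` for the second one. -/
def cams : Set Cameras :=
  {P | (∀ v, rot (P v) * (rot (P v)).transpose = 1 ∧ (rot (P v)).det = 1) ∧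
    rot (P 0) = 1 ∧ transl (P 0) = 0 ∧ transl (P 1) 0 = 1}

/-- Points and lines in the three image planes `ℙ²`, one for each observed point and line. -/
structure JointImage {ι κ : Type} (Q : PointLineProblem ι κ) where
  pt : (v : View) → Q.obsPt v → Grass 1 3
  ln : (v : View) → Q.obsLn v → Grass 2 3

/-- Forget the points outside `S` and the lines outside `T` in all views. -/
def JointImage.restrict {ι κ : Type} {Q : PointLineProblem ι κ} (y : JointImage Q)
    (S : Set ι) (T : Set κ) : JointImage (Q.restrict S T) where
  pt v i := y.pt v ⟨i.1.1, i.2⟩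
  ln v j := y.ln v ⟨j.1.1, j.2⟩

/-! ### Genericity -/

/-- `Generic coord V p`: the property `p` holds for a generic element of the irreducible variety
`V`, that is, on a non-empty Zariski-open subset of `V`. Here `coord x c` says that `c` is a vector
of homogeneous coordinates of `x`; a polynomial `f` in the coordinates gives the open set of those
`x` that have some coordinates `c` with `f c ≠ 0`. -/
def Generic {E σ : Type} (coord : E → (σ → ℂ) → Prop) (V : Set E) (p : E → Prop) : Prop :=
  ∃ f : MvPolynomial σ ℂ,
    (∃ x ∈ V, ∃ c, coord x c ∧ MvPolynomial.eval c f ≠ 0) ∧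
    ∀ x ∈ V, ∀ c, coord x c → MvPolynomial.eval c f ≠ 0 → p x

/-- The rows of `F` form a basis of the `k`-dimensional subspace `W`; these are homogeneous
coordinates of `W`. -/
def IsFrame {k n : ℕ} (W : Grass k n) (F : Fin k → Fin n → ℂ) : Prop :=
  Submodule.span ℂ (Set.range F) = W.1

/-- Coordinates of an arrangement together with three cameras. -/
def sceneCoord {ι κ : Type} (S : Arrangement ι κ × Cameras)
    (c : (ι × Fin 1 × Fin 4) ⊕ (κ × Fin 2 × Fin 4) ⊕ (View × Fin 3 × Fin 4) → ℂ) : Prop :=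
  (∀ i, IsFrame (S.1.pt i) fun a b => c (.inl (i, a, b))) ∧
  (∀ j, IsFrame (S.1.ln j) fun a b => c (.inr (.inl (j, a, b)))) ∧
  ∀ v a b, S.2 v a b = c (.inr (.inr (v, a, b)))

/-- Coordinates of a joint image. -/
def imageCoord {ι κ : Type} {Q : PointLineProblem ι κ} (y : JointImage Q)
    (c : (Σ v : View, Q.obsPt v × Fin 1 × Fin 3) ⊕ (Σ v : View, Q.obsLn v × Fin 2 × Fin 3) → ℂ) :
    Prop :=
  (∀ v i, IsFrame (y.pt v i) fun a b => c (.inl ⟨v, i, a, b⟩)) ∧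
  ∀ v j, IsFrame (y.ln v j) fun a b => c (.inr ⟨v, j, a, b⟩)

/-! ### The joint camera map, camera-minimality and reducibility -/

namespace PointLineProblem

variable {ι κ : Type} (Q : PointLineProblem ι κ)

/-- The variety of point-line arrangements. -/
def arrangements : Set (Arrangement ι κ) :=
  {A | ∀ i j, (i, j) ∈ Q.inc → (A.pt i).1 ≤ (A.ln j).1}

/-- The domain of the joint camera map. -/
def scenes : Set (Arrangement ι κ × Cameras) := Q.arrangements ×ˢ cams

/-- The image variety. -/
def images : Set (JointImage Q) :=
  {y | ∀ v (i : Q.obsPt v) (j : Q.obsLn v), ((i : ι), (j : κ)) ∈ Q.inc →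
    (y.pt v i).1 ≤ (y.ln v j).1}

/-- `y` is the joint image of the arrangement `A` under the cameras `P`: the joint camera map is
defined at `(A, P)` and its value is `y`. (The map is not defined where the centre of a camera is
an observed point or lies on an observed line; there the projection drops in dimension.) -/
def Projects (A : Arrangement ι κ) (P : Cameras) (y : JointImage Q) : Prop :=
  (∀ v (i : Q.obsPt v), (A.pt i).1.map (Matrix.toLin' (P v)) = (y.pt v i).1) ∧
  ∀ v (j : Q.obsLn v), (A.ln j).1.map (Matrix.toLin' (P v)) = (y.ln v j).1

/-- The solutions for a joint image: the fibre of the joint camera map. -/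
def solutions (y : JointImage Q) : Set (Arrangement ι κ × Cameras) :=
  {S | S ∈ Q.scenes ∧ Q.Projects S.1 S.2 y}

/-- The joint camera map is dominant: a generic joint image has a solution. -/
def IsDominant : Prop := Generic imageCoord Q.images fun y => (Q.solutions y).Nonempty

/-- The joint camera map is dominant, and a generic joint image has only finitely many camera
solutions. -/
def IsCameraMinimal : Prop :=
  Q.IsDominant ∧ Generic imageCoord Q.images fun y => (Prod.snd '' Q.solutions y).Finite

/-- `Q` is reducible to the problem that keeps the points in `S` and the lines in `T`: for each
forgotten point at most one pin is kept, and for a generic `(A', P)` in the smaller scene variety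
and a generic `y` in the fibre over its joint image, some arrangement `A` of `Q` lifts `A'` and is
projected to `y` by the same cameras. -/
def ReducibleTo (S : Set ι) (T : Set κ) : Prop :=
  (∀ i, i ∉ S → (Q.pins i ∩ T).Subsingleton) ∧
  Generic sceneCoord (Q.restrict S T).scenes fun S' =>
    Generic imageCoord {y | y ∈ Q.images ∧ (Q.restrict S T).Projects S'.1 S'.2 (y.restrict S T)}
      fun y => ∃ A ∈ Q.arrangements, Q.Projects A S'.2 y ∧ A.restrict S T = S'.1

/-- `Q` is not reducible to another problem, i.e. by forgetting at least one point or line. -/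
def IsReduced : Prop := ∀ S T, Q.ReducibleTo S T → S = Set.univ ∧ T = Set.univ

end PointLineProblem

/-! ### How local features are viewed

A feature is described by the set of views of its point and the sets of views of its pins. The
permutation `s` expresses that the patterns are meant up to permuting the views. -/

/-- A line observed by exactly one view. -/
def Dangling (V : Set View) : Prop := ∃ v, V = {v}

/-- Points without pins in reduced minimal problems: seen in all views or in exactly two. -/
def ZeroPinsTable (X : Set View) : Prop :=
  X = Set.univ ∨ ∃ s : Equiv.Perm View, X = {s 0, s 1}

/-- Points with one pin in reduced minimal problems; `X` are the views of the point and `L` those of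
the pin. -/
def OnePinTable (X L : Set View) : Prop :=
  (X = Set.univ ∧ L = Set.univ) ∨
  ∃ s : Equiv.Perm View,
    (X = {s 0, s 1} ∧ L = Set.univ) ∨
    (X = {s 0, s 1} ∧ L = {s 1, s 2}) ∨
    (X = {s 0} ∧ L = {s 1, s 2})

/-- A point with one pin, which is dangling. -/
def OnePinDangling (X L : Set View) : Prop :=
  Dangling L ∧ ∃ s : Equiv.Perm View, X = {s 0, s 1} ∧ L = {s 2}

/-- Points with two pins in reduced minimal problems; `L` and `L'` are the views of the pins. -/
def TwoPinsTable (X L L' : Set View) : Prop :=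
  (X = Set.univ ∧ L = Set.univ ∧ L' = Set.univ) ∨
  ∃ s : Equiv.Perm View, X = {s 0} ∧ L = {s 0, s 1} ∧ L' = {s 0, s 2}

/-- A point with two pins, both of them dangling. -/
def TwoPinsBothDangling (X L L' : Set View) : Prop :=
  Dangling L ∧ Dangling L' ∧
    ∃ s : Equiv.Perm View, X = {s 0} ∧ L = {s 1} ∧ L' = {s 2}

/-- A point with two pins, of which exactly the one seen in `L` is dangling. -/
def TwoPinsOneDangling (X L L' : Set View) : Prop :=
  Dangling L ∧ ¬ Dangling L' ∧
    ∃ s : Equiv.Perm View, X = {s 0} ∧ L = {s 1} ∧ L' = {s 0, s 2}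

end PointLine

/-! The viewing patterns follow from reducedness, the bounds on the pins from dominance of the joint
camera map.

Patterns. An image point back-projects to a ray and an image line to a plane. A forgotten feature
can be recovered when these rays and planes always have the required intersection: two planes share
a line, which passes through any point seen on both image lines; a plane meets a kept line or a ray
in a point; three planes meet in a point. Each `reducibleTo_of_...` lemma for a local feature treats
one such situation. Excluding all of them, and using `obs_meet`, leaves the listed patterns by a
case analysis on subsets of three views (`onePinTable_of`, `twoPinsTable_of`,
`IsReduced.views_of_three_le`). The intersections are in good position as soon as no epipole lies on
a forgotten image feature and the kept scene is good. `reducibleTo_of_lift` reduces to this case,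
because these conditions are polynomial and `generic_isGoodScene` and `exists_isGoodImage` supply a
witness.

Bounds. By `IsDominant.exists_solution` some joint image with algebraically independent parameters
has a solution. For a point completely seen in all views, the three image directions of a pin
satisfy a trilinear relation on the three pencils of lines (`exists_trilinear_relation`). Its eight
coefficients depend on the cameras and the point but not on the pin, and eight independent triples
satisfy no such relation, so there are at most seven pins. Two points with three pins each have
joint images of dimension 3·2·(2+3) = 30, but scenes only of dimension 11 + 2·(3+3·2) = 29.
`card_le_of_mem_adjoin` turns this count into a contradiction of transcendence degrees. -/

namespace PointLine

open Matrix

/-! ### Subspaces of `ℂ³` -/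

/-- A vector space is not the union of two proper subspaces. Two suffice because each view contains
just two epipoles to be avoided. -/
theorem exists_mem_notMem_notMem {E : Type*} [AddCommGroup E] [Module ℂ E]
    {W A B : Submodule ℂ E} (hA : ¬ W ≤ A) (hB : ¬ W ≤ B) : ∃ x ∈ W, x ∉ A ∧ x ∉ B := by
  obtain ⟨a, haW, haA⟩ := SetLike.not_le_iff_exists.1 hA
  obtain ⟨b, hbW, hbB⟩ := SetLike.not_le_iff_exists.1 hB
  by_cases h1 : a ∈ B
  · by_cases h2 : b ∈ A
    · exact ⟨a + b, W.add_mem haW hbW, fun h => haA (by simpa using A.sub_mem h h2),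
        fun h => hbB (by simpa using B.sub_mem h h1)⟩
    · exact ⟨b, hbW, h2, hbB⟩
  · exact ⟨a, haW, haA, h1⟩

theorem not_le_of_finrank_lt {n : ℕ} {W A : Submodule ℂ (Fin n → ℂ)}
    (h : Module.finrank ℂ A < Module.finrank ℂ W) : ¬ W ≤ A :=
  fun h' => absurd (Submodule.finrank_mono h') (by omega)

theorem finrank_span_pair_le {n : ℕ} (x y : Fin n → ℂ) :
    Module.finrank ℂ (Submodule.span ℂ {x, y}) ≤ 2 := by
  have := finrank_range_le_card (R := ℂ) ![x, y]
  rwa [Set.finrank, Matrix.range_cons_cons_empty, Fintype.card_fin] at this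

theorem finrank_span_singleton_le {n : ℕ} (x : Fin n → ℂ) :
    Module.finrank ℂ (Submodule.span ℂ {x}) ≤ 1 := by
  by_cases h : x = 0
  · subst h
    rw [Submodule.span_zero_singleton, finrank_bot]
    exact zero_le_one
  · exact (finrank_span_singleton h).le

theorem finrank_span_pair {n : ℕ} {x y : Fin n → ℂ}
    (h : ∀ a b : ℂ, a • x + b • y = 0 → a = 0 ∧ b = 0) :
    Module.finrank ℂ (Submodule.span ℂ {x, y}) = 2 := by
  have hli : LinearIndependent ℂ ![x, y] := LinearIndependent.pair_iff.2 h
  have := finrank_span_eq_card hli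
  rwa [Matrix.range_cons_cons_empty, Fintype.card_fin] at this

theorem span_pair_eq_of_mem {n : ℕ} {W : Submodule ℂ (Fin n → ℂ)} (hW : Module.finrank ℂ W = 2)
    {x y : Fin n → ℂ} (hx : x ∈ W) (hy : y ∈ W)
    (h : ∀ a b : ℂ, a • x + b • y = 0 → a = 0 ∧ b = 0) :
    Submodule.span ℂ {x, y} = W := by
  apply Submodule.eq_of_le_of_finrank_eq
  · rw [Submodule.span_le]
    rintro z (rfl | rfl) <;> assumption
  · rw [finrank_span_pair h, hW]

theorem span_singleton_eq_of_mem {n : ℕ} {W : Submodule ℂ (Fin n → ℂ)}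
    (hW : Module.finrank ℂ W = 1) {x : Fin n → ℂ} (hx : x ∈ W) (h : x ≠ 0) :
    Submodule.span ℂ {x} = W := by
  apply Submodule.eq_of_le_of_finrank_eq
  · rwa [Submodule.span_singleton_le_iff_mem]
  · rw [finrank_span_singleton h, hW]

theorem exists_ne_zero_of_finrank {n : ℕ} {W : Submodule ℂ (Fin n → ℂ)}
    (hW : Module.finrank ℂ W ≠ 0) : ∃ x ∈ W, x ≠ 0 := by
  apply Submodule.exists_mem_ne_zero_of_ne_bot
  rintro rfl
  simp at hW

/-- A nonzero vector and a vector outside its span are independent. -/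
theorem pair_independent {E : Type*} [AddCommGroup E] [Module ℂ E] {x y : E} (hx : x ≠ 0)
    (hy : y ∉ Submodule.span ℂ {x}) (a b : ℂ) (h : a • x + b • y = 0) : a = 0 ∧ b = 0 := by
  have hb : b = 0 := by
    by_contra hb
    apply hy
    rw [Submodule.mem_span_singleton]
    refine ⟨-(b⁻¹ * a), ?_⟩
    have : b⁻¹ • (a • x + b • y) = 0 := by rw [h, smul_zero]
    rw [smul_add, smul_smul, smul_smul, inv_mul_cancel₀ hb, one_smul] at this
    rw [neg_smul]
    exact (eq_neg_of_add_eq_zero_right this).symm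
  subst hb
  simpa [hx] using h

/-- In a plane through `x` there is a second spanning vector. -/
theorem exists_span_pair_eq {n : ℕ} {W : Submodule ℂ (Fin n → ℂ)} (hW : Module.finrank ℂ W = 2)
    {x : Fin n → ℂ} (hx : x ∈ W) (h0 : x ≠ 0) :
    ∃ y ∈ W, y ∉ Submodule.span ℂ {x} ∧ Submodule.span ℂ {x, y} = W := by
  have : ¬ W ≤ Submodule.span ℂ {x} := not_le_of_finrank_lt (by
    have := finrank_span_singleton_le x
    omega)
  obtain ⟨y, hy, hyx⟩ := SetLike.not_le_iff_exists.1 this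
  exact ⟨y, hy, hyx, span_pair_eq_of_mem hW hx hy (pair_independent h0 hyx)⟩

/-- A line of the projective plane is the zero set of a linear form. -/
theorem exists_normal {W : Submodule ℂ (Fin 3 → ℂ)} (hW : Module.finrank ℂ W = 2) :
    ∃ φ : (Fin 3 → ℂ) →ₗ[ℂ] ℂ, ∀ z, z ∈ W ↔ φ z = 0 := by
  obtain ⟨φ, h0, h⟩ := W.exists_le_ker_of_lt_top (by
    rw [lt_top_iff_ne_top]
    rintro rfl
    simp at hW)
  have : W = LinearMap.ker φ := by
    apply Submodule.eq_of_le_of_finrank_eq h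
    have h1 := φ.finrank_range_add_finrank_ker
    have h2 : Module.finrank ℂ (LinearMap.range φ) = 1 := by
      rw [LinearMap.range_eq_top.2 (LinearMap.surjective h0)]
      simp
    simp only [Module.finrank_fintype_fun_eq_card, Fintype.card_fin] at h1
    omega
  exact ⟨φ, fun z => by rw [this]; simp⟩

theorem exists_add_smul_mem {W : Submodule ℂ (Fin 3 → ℂ)} (hW : Module.finrank ℂ W = 2)
    {e : Fin 3 → ℂ} (he : e ∉ W) (z : Fin 3 → ℂ) : ∃ τ : ℂ, z + τ • e ∈ W := by
  obtain ⟨φ, hφ⟩ := exists_normal hW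
  have he' : φ e ≠ 0 := fun h => he ((hφ e).2 h)
  refine ⟨-(φ z / φ e), (hφ _).2 ?_⟩
  simp only [map_add, map_smul, smul_eq_mul]
  field_simp
  ring

theorem exists_smul_add_smul_mem {W : Submodule ℂ (Fin 3 → ℂ)} (hW : Module.finrank ℂ W = 2)
    (p q : Fin 3 → ℂ) : ∃ a b : ℂ, (a ≠ 0 ∨ b ≠ 0) ∧ a • p + b • q ∈ W := by
  obtain ⟨φ, hφ⟩ := exists_normal hW
  by_cases h : φ p = 0
  · exact ⟨1, 0, by simp, by simpa [hφ] using h⟩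
  · refine ⟨φ q, -φ p, by simp [h], ?_⟩
    rw [hφ]
    simp only [map_add, map_smul, smul_eq_mul]
    ring

/-- Every subspace of `ℂⁿ` of dimension at least two contains a line through the origin that avoids
two given nonzero vectors. -/
theorem exists_point_avoiding {n : ℕ} {W : Submodule ℂ (Fin n → ℂ)}
    (hW : 2 ≤ Module.finrank ℂ W) {e e' : Fin n → ℂ} (he : e ≠ 0) (he' : e' ≠ 0) :
    ∃ x : Grass 1 n, x.1 ≤ W ∧ e ∉ x.1 ∧ e' ∉ x.1 := by
  have aux (e : Fin n → ℂ) : ¬ W ≤ Submodule.span ℂ {e} := not_le_of_finrank_lt (by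
    have := finrank_span_singleton_le e
    omega)
  have aux' {e x : Fin n → ℂ} (he : e ≠ 0) (hx : x ∉ Submodule.span ℂ {e}) :
      e ∉ Submodule.span ℂ {x} := by
    rw [Submodule.mem_span_singleton] at hx ⊢
    rintro ⟨a, rfl⟩
    have ha : a ≠ 0 := by
      rintro rfl
      simp at he
    exact hx ⟨a⁻¹, by rw [smul_smul, inv_mul_cancel₀ ha, one_smul]⟩
  obtain ⟨x, hx, h1, h2⟩ := exists_mem_notMem_notMem (aux e) (aux e')
  have hx0 : x ≠ 0 := by
    rintro rfl
    exact h1 (Submodule.zero_mem _)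
  exact ⟨⟨_, finrank_span_singleton hx0⟩, by simpa using hx, aux' he h1, aux' he' h2⟩

/-- Through every point of the projective plane there is a line that avoids two other points. -/
theorem exists_line_avoiding (x : Grass 1 3) {e e' : Fin 3 → ℂ} (he : e ∉ x.1) (he' : e' ∉ x.1) :
    ∃ ℓ : Grass 2 3, x.1 ≤ ℓ.1 ∧ e ∉ ℓ.1 ∧ e' ∉ ℓ.1 := by
  obtain ⟨y, hy, hy0⟩ := exists_ne_zero_of_finrank (W := x.1) (by rw [x.2]; simp)
  have hyx := span_singleton_eq_of_mem x.2 hy hy0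
  rw [← hyx] at he he'
  have aux (e : Fin 3 → ℂ) : ¬ ⊤ ≤ Submodule.span ℂ {y, e} := not_le_of_finrank_lt (by
    have := finrank_span_pair_le y e
    simp
    omega)
  have aux' {e w : Fin 3 → ℂ} (he : e ∉ Submodule.span ℂ {y}) (hx : w ∉ Submodule.span ℂ {y, e}) :
      e ∉ Submodule.span ℂ {y, w} := by
    intro h
    rw [Submodule.mem_span_pair] at h
    obtain ⟨a, b, rfl⟩ := h
    have hb : b ≠ 0 := by
      rintro rfl
      exact he (by simpa using Submodule.smul_mem _ _ (Submodule.mem_span_singleton_self y))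
    apply hx
    rw [Submodule.mem_span_pair]
    refine ⟨-(b⁻¹ * a), b⁻¹, ?_⟩
    rw [smul_add, smul_smul, smul_smul, inv_mul_cancel₀ hb]
    simp
  obtain ⟨w, -, h1, h2⟩ := exists_mem_notMem_notMem (aux e) (aux e')
  refine ⟨⟨Submodule.span ℂ {y, w}, finrank_span_pair (pair_independent hy0 fun h => h1 ?_)⟩,
    ?_, aux' he h1, aux' he' h2⟩
  · exact Submodule.span_mono (by simp) h
  · rw [← hyx]
    exact Submodule.span_mono (by simp)

/-! ### Calibrated cameras -/

/-- The block `R` of the camera `[R | t]` is orthogonal. -/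
def IsCalibrated (P : Matrix (Fin 3) (Fin 4) ℂ) : Prop := rot P * (rot P)ᵀ = 1

theorem isCalibrated_of_mem_cams {P : Cameras} (hP : P ∈ cams) (v : View) : IsCalibrated (P v) :=
  (hP.1 v).1

/-- The centre of a camera. -/
def center (P : Matrix (Fin 3) (Fin 4) ℂ) : Fin 4 → ℂ :=
  Fin.snoc (α := fun _ => ℂ) (-((rot P)ᵀ *ᵥ transl P)) 1

/-- The image of the centre of the camera `P'` under the camera `P`. -/
def epipole (P P' : Matrix (Fin 3) (Fin 4) ℂ) : Fin 3 → ℂ := P *ᵥ center P'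

theorem mulVec_eq_rot_add_transl (P : Matrix (Fin 3) (Fin 4) ℂ) (z : Fin 4 → ℂ) :
    P *ᵥ z = rot P *ᵥ (fun a => z (Fin.castSucc a)) + z 3 • transl P := by
  ext a
  simp [Matrix.mulVec, dotProduct, Fin.sum_univ_succ, rot, transl]
  ring_nf

theorem mulVec_snoc (P : Matrix (Fin 3) (Fin 4) ℂ) (z : Fin 3 → ℂ) (s : ℂ) :
    P *ᵥ (Fin.snoc (α := fun _ => ℂ) z s) = rot P *ᵥ z + s • transl P := by
  rw [mulVec_eq_rot_add_transl]
  congr 2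
  · ext a
    simp

theorem mulVec_center {P : Matrix (Fin 3) (Fin 4) ℂ} (hP : IsCalibrated P) :
    P *ᵥ center P = 0 := by
  rw [center, mulVec_snoc, mulVec_neg, mulVec_mulVec, hP]
  simp

/-- Since the block R is invertible, the kernel is a line; the factor is the last coordinate because
the centre is normalized to end in 1. -/
theorem eq_smul_center {P : Matrix (Fin 3) (Fin 4) ℂ} (hP : IsCalibrated P) {z : Fin 4 → ℂ}
    (hz : P *ᵥ z = 0) : z = z 3 • center P := by
  rw [mulVec_eq_rot_add_transl] at hz
  have h : (rot P)ᵀ * rot P = 1 := mul_eq_one_comm.1 hP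
  have h1 := congrArg (fun w => (rot P)ᵀ *ᵥ w) hz
  simp only [mulVec_add, mulVec_mulVec, h, one_mulVec, mulVec_zero, mulVec_smul] at h1
  have h2 := eq_neg_of_add_eq_zero_left h1
  ext a
  refine Fin.lastCases ?_ (fun a => ?_) a
  · have : center P (Fin.last 3) = 1 := Fin.snoc_last (α := fun _ => ℂ) _ _
    change z 3 = z 3 * center P (Fin.last 3)
    rw [this, mul_one]
  · have : center P a.castSucc = -((rot P)ᵀ *ᵥ transl P) a := by simp [center]
    simp [this]
    simpa using congrFun h2 a

theorem exists_mulVec_eq {P : Matrix (Fin 3) (Fin 4) ℂ} (hP : IsCalibrated P) (p : Fin 3 → ℂ) :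
    ∃ z, P *ᵥ z = p := by
  refine ⟨Fin.snoc (α := fun _ => ℂ) ((rot P)ᵀ *ᵥ p) 0, ?_⟩
  rw [mulVec_snoc, mulVec_mulVec, hP]
  simp

/-- A point which another camera does not see at the epipole of `P'` is not the centre of `P'`. -/
theorem mulVec_ne_zero_of_notMem {P P' : Matrix (Fin 3) (Fin 4) ℂ} (hP' : IsCalibrated P')
    {W : Submodule ℂ (Fin 3 → ℂ)} (he : epipole P P' ∉ W) {z : Fin 4 → ℂ} (hz : P *ᵥ z ∈ W)
    (h0 : P *ᵥ z ≠ 0) : P' *ᵥ z ≠ 0 := by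
  intro h
  have hz' := eq_smul_center hP' h
  have h1 : P *ᵥ z = z 3 • epipole P P' := by
    conv_lhs => rw [hz', mulVec_smul]
    rfl
  have h2 : z 3 ≠ 0 := by
    intro h3
    rw [h3, zero_smul] at h1
    exact h0 h1
  rw [h1] at hz
  exact he ((Submodule.smul_mem_iff _ h2).1 hz)

/-- A point seen at a given place by `P` and on a given line by `P'`. -/
theorem exists_mulVec_eq_mulVec_mem {P P' : Matrix (Fin 3) (Fin 4) ℂ} (hP : IsCalibrated P)
    {ℓ : Grass 2 3} (he : epipole P' P ∉ ℓ.1) (p : Fin 3 → ℂ) :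
    ∃ z, P *ᵥ z = p ∧ P' *ᵥ z ∈ ℓ.1 := by
  obtain ⟨z, rfl⟩ := exists_mulVec_eq hP p
  -- Moving `z` along its viewing ray, towards the centre of `P`, fixes its image under `P` and
  -- moves its image under `P'` towards the epipole. As the epipole is off `ℓ`, the line `ℓ` is hit.
  obtain ⟨τ, hτ⟩ := exists_add_smul_mem ℓ.2 he (P' *ᵥ z)
  refine ⟨z + τ • center P, ?_, ?_⟩
  · rw [mulVec_add, mulVec_smul, mulVec_center hP]
    simp
  · rwa [mulVec_add, mulVec_smul]

theorem map_span_pair (P : Matrix (Fin 3) (Fin 4) ℂ) (x y : Fin 4 → ℂ) :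
    (Submodule.span ℂ {x, y}).map (toLin' P) = Submodule.span ℂ {P *ᵥ x, P *ᵥ y} := by
  rw [Submodule.map_span, Set.image_pair]
  simp

theorem map_span_singleton (P : Matrix (Fin 3) (Fin 4) ℂ) (x : Fin 4 → ℂ) :
    (Submodule.span ℂ {x}).map (toLin' P) = Submodule.span ℂ {P *ᵥ x} := by
  rw [Submodule.map_span, Set.image_singleton]
  simp

theorem finrank_span_pair_of_mulVec {P : Matrix (Fin 3) (Fin 4) ℂ} {x y : Fin 4 → ℂ}
    (h : Module.finrank ℂ (Submodule.span ℂ {P *ᵥ x, P *ᵥ y}) = 2) :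
    Module.finrank ℂ (Submodule.span ℂ {x, y}) = 2 := by
  apply le_antisymm (finrank_span_pair_le x y)
  rw [← h, ← map_span_pair]
  exact Submodule.finrank_map_le _ _

/-- A line in space through a given point with a given image in one view. -/
theorem exists_line_of_one_view {P : Matrix (Fin 3) (Fin 4) ℂ} (hP : IsCalibrated P)
    {ℓ : Grass 2 3} {ξ : Fin 4 → ℂ} (hξ : P *ᵥ ξ ∈ ℓ.1) (h0 : P *ᵥ ξ ≠ 0) :
    ∃ L : Grass 2 4, ξ ∈ L.1 ∧ L.1.map (toLin' P) = ℓ.1 := by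
  obtain ⟨y, hy, -, hspan⟩ := exists_span_pair_eq ℓ.2 hξ h0
  obtain ⟨η, rfl⟩ := exists_mulVec_eq hP y
  refine ⟨⟨Submodule.span ℂ {ξ, η}, finrank_span_pair_of_mulVec (P := P) ?_⟩,
    Submodule.subset_span (by simp), ?_⟩
  · rw [hspan, ℓ.2]
  · rw [map_span_pair, hspan]

/-- A line in space through a given point with given images in two views. -/
theorem exists_line_of_two_views {P P' : Matrix (Fin 3) (Fin 4) ℂ} (hP : IsCalibrated P)
    (hP' : IsCalibrated P') {ℓ ℓ' : Grass 2 3} (he : epipole P P' ∉ ℓ.1)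
    (he' : epipole P' P ∉ ℓ'.1) {ξ : Fin 4 → ℂ}
    (hξ : P *ᵥ ξ ∈ ℓ.1) (h0 : P *ᵥ ξ ≠ 0) (hξ' : P' *ᵥ ξ ∈ ℓ'.1) (h0' : P' *ᵥ ξ ≠ 0) :
    ∃ L : Grass 2 4, ξ ∈ L.1 ∧ L.1.map (toLin' P) = ℓ.1 ∧ L.1.map (toLin' P') = ℓ'.1 := by
  obtain ⟨y, hy, hyξ, hspan⟩ := exists_span_pair_eq ℓ.2 hξ h0
  obtain ⟨η, rfl, hη⟩ := exists_mulVec_eq_mulVec_mem hP he' y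
  refine ⟨⟨Submodule.span ℂ {ξ, η}, finrank_span_pair_of_mulVec (P := P) ?_⟩,
    Submodule.subset_span (by simp), ?_, ?_⟩
  · rw [hspan, ℓ.2]
  · rw [map_span_pair, hspan]
  · rw [map_span_pair]
    refine span_pair_eq_of_mem ℓ'.2 hξ' hη (pair_independent h0' ?_)
    rw [Submodule.mem_span_singleton]
    rintro ⟨a, ha⟩
    -- If the two points had the same image under `P'`, then `η - a • ξ` would be the centre of
    -- `P'`, and `P` would see it on `ℓ`, at an epipole excluded by `he`.
    have h1 : P *ᵥ (η - a • ξ) ∈ ℓ.1 := by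
      rw [mulVec_sub, mulVec_smul]
      exact ℓ.1.sub_mem hy (ℓ.1.smul_mem _ hξ)
    refine mulVec_ne_zero_of_notMem hP' he h1 (fun h => hyξ ?_) ?_
    · rw [mulVec_sub, mulVec_smul, sub_eq_zero] at h
      rw [h]
      exact Submodule.smul_mem _ _ (Submodule.mem_span_singleton_self _)
    · rw [mulVec_sub, mulVec_smul, ha, sub_self]

/-- A point in space whose images in two views are on given lines. -/
theorem exists_point_of_two_lines {P P' : Matrix (Fin 3) (Fin 4) ℂ} (hP : IsCalibrated P)
    (hP' : IsCalibrated P') {ℓ ℓ' : Grass 2 3} (he : epipole P P' ∉ ℓ.1)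
    (he' : epipole P' P ∉ ℓ'.1) :
    ∃ ξ, P *ᵥ ξ ∈ ℓ.1 ∧ P *ᵥ ξ ≠ 0 ∧ P' *ᵥ ξ ∈ ℓ'.1 ∧ P' *ᵥ ξ ≠ 0 := by
  obtain ⟨p, hp, hp0⟩ := exists_ne_zero_of_finrank (W := ℓ.1) (by rw [ℓ.2]; simp)
  obtain ⟨ξ, rfl, hξ⟩ := exists_mulVec_eq_mulVec_mem hP he' p
  exact ⟨ξ, hp, hp0, hξ, mulVec_ne_zero_of_notMem hP' he hp hp0⟩

/-- A line in space meets the plane that is seen as a given line. -/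
theorem exists_mem_mulVec_mem (P : Matrix (Fin 3) (Fin 4) ℂ) (ℓ : Grass 2 3) (L : Grass 2 4) :
    ∃ ξ ∈ L.1, ξ ≠ 0 ∧ P *ᵥ ξ ∈ ℓ.1 := by
  obtain ⟨x, hx, hx0⟩ := exists_ne_zero_of_finrank (W := L.1) (by rw [L.2]; simp)
  obtain ⟨y, hy, hyx, -⟩ := exists_span_pair_eq L.2 hx hx0
  obtain ⟨a, b, hab, h⟩ := exists_smul_add_smul_mem ℓ.2 (P *ᵥ x) (P *ᵥ y)
  refine ⟨a • x + b • y, L.1.add_mem (L.1.smul_mem _ hx) (L.1.smul_mem _ hy), fun h0 => ?_, ?_⟩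
  · have := pair_independent hx0 hyx a b h0
    tauto
  · rwa [mulVec_add, mulVec_smul, mulVec_smul]

/-- A camera is injective on a line whose image is a line. -/
theorem mulVec_ne_zero_of_map_eq {P : Matrix (Fin 3) (Fin 4) ℂ} {k : ℕ} {L : Grass k 4}
    {ℓ : Grass k 3} (h : L.1.map (toLin' P) = ℓ.1) {ξ : Fin 4 → ℂ} (hξ : ξ ∈ L.1) (h0 : ξ ≠ 0) :
    P *ᵥ ξ ≠ 0 := by
  intro hP
  have h1 := ((toLin' P).domRestrict L.1).finrank_range_add_finrank_ker
  rw [LinearMap.range_domRestrict, h, ℓ.2, L.2] at h1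
  have h2 : LinearMap.ker ((toLin' P).domRestrict L.1) = ⊥ := by
    apply Submodule.finrank_eq_zero.1
    omega
  have h3 : (⟨ξ, hξ⟩ : L.1) ∈ LinearMap.ker ((toLin' P).domRestrict L.1) := by
    simpa using hP
  rw [h2] at h3
  exact h0 (by simpa using h3)

/-- A point in space whose images in three views are on given lines. -/
theorem exists_point_of_three_lines {P : Cameras} (hP : ∀ v, IsCalibrated (P v))
    (ℓ : View → Grass 2 3) (he : ∀ v u, v ≠ u → epipole (P v) (P u) ∉ (ℓ v).1) :
    ∃ ξ, ∀ v, P v *ᵥ ξ ∈ (ℓ v).1 ∧ P v *ᵥ ξ ≠ 0 := by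
  obtain ⟨ξ₀, h0, h1, h2, h3⟩ := exists_point_of_two_lines (hP 0) (hP 1)
    (he 0 1 (by decide)) (he 1 0 (by decide))
  obtain ⟨L, -, hL, hL'⟩ := exists_line_of_two_views (hP 0) (hP 1)
    (he 0 1 (by decide)) (he 1 0 (by decide)) h0 h1 h2 h3
  -- `L` lies in the planes of views 0 and 1 and meets the plane of view 2. The meeting point is not
  -- the centre of camera 2, as that centre is seen off `ℓ 0`.
  obtain ⟨ξ, hξ, hξ0, hξ2⟩ := exists_mem_mulVec_mem (P 2) (ℓ 2) L
  have m0 : P 0 *ᵥ ξ ∈ (ℓ 0).1 := by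
    rw [← hL]
    exact ⟨ξ, hξ, by simp⟩
  have m1 : P 1 *ᵥ ξ ∈ (ℓ 1).1 := by
    rw [← hL']
    exact ⟨ξ, hξ, by simp⟩
  have n0 := mulVec_ne_zero_of_map_eq hL hξ hξ0
  have n1 := mulVec_ne_zero_of_map_eq hL' hξ hξ0
  have n2 := mulVec_ne_zero_of_notMem (hP 2) (he 0 2 (by decide)) m0 n0
  refine ⟨ξ, fun v => ?_⟩
  fin_cases v
  exacts [⟨m0, n0⟩, ⟨m1, n1⟩, ⟨hξ2, n2⟩]

/-- A line in space with given images in at most two views. -/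
theorem exists_line_of_views {P : Cameras} (hP : ∀ v, IsCalibrated (P v)) {V : Set View}
    (hV : V ≠ Set.univ) (ℓ : V → Grass 2 3)
    (he : ∀ (v : V) (u : View), v.1 ≠ u → epipole (P v) (P u) ∉ (ℓ v).1)
    {ξ : Fin 4 → ℂ} (h0 : ξ ≠ 0) (hξ : ∀ v : V, P v *ᵥ ξ ∈ (ℓ v).1 ∧ P v *ᵥ ξ ≠ 0) :
    ∃ L : Grass 2 4, ξ ∈ L.1 ∧ ∀ v : V, L.1.map (toLin' (P v)) = (ℓ v).1 := by
  by_cases h : ∃ u v, u ∈ V ∧ v ∈ V ∧ u ≠ v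
  · obtain ⟨u, v, hu, hv, huv⟩ := h
    obtain ⟨L, h1, h2, h3⟩ := exists_line_of_two_views (hP u) (hP v) (he ⟨u, hu⟩ v huv)
      (he ⟨v, hv⟩ u huv.symm) (hξ ⟨u, hu⟩).1 (hξ ⟨u, hu⟩).2 (hξ ⟨v, hv⟩).1 (hξ ⟨v, hv⟩).2
    refine ⟨L, h1, fun ⟨w, hw⟩ => ?_⟩
    by_cases hwu : w = u
    · subst hwu; exact h2
    by_cases hwv : w = v
    · subst hwv; exact h3
    refine absurd (Set.eq_univ_of_forall fun x => ?_) hV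
    have : x = u ∨ x = v ∨ x = w := by
      revert huv hwu hwv
      clear * -
      revert x u v w
      decide
    rcases this with rfl | rfl | rfl <;> assumption
  · by_cases hne : V.Nonempty
    · obtain ⟨v, hv⟩ := hne
      obtain ⟨L, h1, h2⟩ := exists_line_of_one_view (hP v) (hξ ⟨v, hv⟩).1 (hξ ⟨v, hv⟩).2
      refine ⟨L, h1, fun ⟨w, hw⟩ => ?_⟩
      have : w = v := by
        by_contra hwv
        exact h ⟨w, v, hw, hv, hwv⟩
      subst this
      exact h2
    · obtain ⟨η, -, hη⟩ := SetLike.not_le_iff_exists.1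
        (not_le_of_finrank_lt (W := ⊤) (A := Submodule.span ℂ {ξ}) (by
          have := finrank_span_singleton_le ξ
          simp
          omega))
      exact ⟨⟨_, finrank_span_pair (pair_independent h0 hη)⟩, Submodule.subset_span (by simp),
        fun v => absurd ⟨v.1, v.2⟩ hne⟩

/-! ### Generic properties near a point -/

/-- Polynomial functions of the coordinates. -/
def IsPolynomial {σ : Type} (g : (σ → ℂ) → ℂ) : Prop :=
  ∃ f : MvPolynomial σ ℂ, ∀ c, MvPolynomial.eval c f = g c

namespace IsPolynomial

variable {σ : Type} {g h : (σ → ℂ) → ℂ}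

theorem const (a : ℂ) : IsPolynomial fun _ : σ → ℂ => a := ⟨MvPolynomial.C a, by simp⟩

theorem coord (s : σ) : IsPolynomial fun c : σ → ℂ => c s := ⟨MvPolynomial.X s, by simp⟩

theorem add (hg : IsPolynomial g) (hh : IsPolynomial h) : IsPolynomial fun c => g c + h c := by
  obtain ⟨f, hf⟩ := hg
  obtain ⟨f', hf'⟩ := hh
  exact ⟨f + f', fun c => by simp [hf, hf']⟩

theorem mul (hg : IsPolynomial g) (hh : IsPolynomial h) : IsPolynomial fun c => g c * h c := by
  obtain ⟨f, hf⟩ := hg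
  obtain ⟨f', hf'⟩ := hh
  exact ⟨f * f', fun c => by simp [hf, hf']⟩

theorem sub (hg : IsPolynomial g) (hh : IsPolynomial h) : IsPolynomial fun c => g c - h c := by
  obtain ⟨f, hf⟩ := hg
  obtain ⟨f', hf'⟩ := hh
  exact ⟨f - f', fun c => by simp [hf, hf']⟩

theorem sum {α : Type*} {s : Finset α} {g : α → (σ → ℂ) → ℂ} (hg : ∀ a, IsPolynomial (g a)) :
    IsPolynomial fun c => ∑ a ∈ s, g a c := by
  choose f hf using hg
  exact ⟨∑ a ∈ s, f a, fun c => by simp [hf]⟩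

theorem mulVec {m n : ℕ} {M : (σ → ℂ) → Matrix (Fin m) (Fin n) ℂ} {w : (σ → ℂ) → Fin n → ℂ}
    (hM : ∀ a b, IsPolynomial fun c => M c a b) (hw : ∀ b, IsPolynomial fun c => w c b)
    (a : Fin m) : IsPolynomial fun c => (M c *ᵥ w c) a := by
  simp only [Matrix.mulVec, dotProduct]
  exact sum fun b => (hM a b).mul (hw b)

theorem det {M : (σ → ℂ) → Matrix (Fin 3) (Fin 3) ℂ}
    (hM : ∀ a b, IsPolynomial fun c => M c a b) : IsPolynomial fun c => (M c).det := by
  choose f hf using hM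
  refine ⟨(Matrix.of f).det, fun c => ?_⟩
  rw [RingHom.map_det]
  congr 1
  ext a b
  simp [hf]

end IsPolynomial

/-- The property `p` holds where some polynomial which does not vanish at `c₀` is nonzero. -/
def NearGeneric {E σ : Type} (coord : E → (σ → ℂ) → Prop) (V : Set E) (c₀ : σ → ℂ)
    (p : E → Prop) : Prop :=
  ∃ f : MvPolynomial σ ℂ, MvPolynomial.eval c₀ f ≠ 0 ∧
    ∀ x ∈ V, ∀ c, coord x c → MvPolynomial.eval c f ≠ 0 → p x

namespace NearGeneric

variable {E σ : Type} {coord : E → (σ → ℂ) → Prop} {V : Set E} {c₀ : σ → ℂ} {p q : E → Prop}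

theorem generic (h : NearGeneric coord V c₀ p) {x : E} (hx : x ∈ V) (hc : coord x c₀) :
    Generic coord V p := by
  obtain ⟨f, h0, h⟩ := h
  exact ⟨f, ⟨x, hx, c₀, hc, h0⟩, h⟩

theorem of_isPolynomial {g : (σ → ℂ) → ℂ} (hg : IsPolynomial g) (h0 : g c₀ ≠ 0)
    (h : ∀ x ∈ V, ∀ c, coord x c → g c ≠ 0 → p x) : NearGeneric coord V c₀ p := by
  obtain ⟨f, hf⟩ := hg
  exact ⟨f, by rwa [hf], fun x hx c hc hfc => h x hx c hc (by rwa [← hf])⟩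

/-- Both polynomials are nonzero at the same `c₀`, hence so is their product. Fixing one witness
replaces the irreducibility of `V`, which is never proved. -/
theorem and (hp : NearGeneric coord V c₀ p) (hq : NearGeneric coord V c₀ q) :
    NearGeneric coord V c₀ fun x => p x ∧ q x := by
  obtain ⟨f, h0, h⟩ := hp
  obtain ⟨f', h0', h'⟩ := hq
  refine ⟨f * f', by simp [h0, h0'], fun x hx c hc hfc => ?_⟩
  rw [map_mul, mul_ne_zero_iff] at hfc
  exact ⟨h x hx c hc hfc.1, h' x hx c hc hfc.2⟩

theorem forall_finite {α : Type*} [Finite α] {p : α → E → Prop}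
    (hp : ∀ a, NearGeneric coord V c₀ (p a)) : NearGeneric coord V c₀ fun x => ∀ a, p a x := by
  cases nonempty_fintype α
  choose f h0 h using hp
  refine ⟨∏ a, f a, ?_, fun x hx c hc hfc a => ?_⟩
  · rw [map_prod]
    exact Finset.prod_ne_zero_iff.2 fun a _ => h0 a
  · rw [map_prod] at hfc
    exact h a x hx c hc (Finset.prod_ne_zero_iff.1 hfc a (Finset.mem_univ a))

theorem imp {r : Prop} (hp : r → NearGeneric coord V c₀ p) :
    NearGeneric coord V c₀ fun x => r → p x := by
  by_cases hr : r
  · obtain ⟨f, h0, h⟩ := hp hr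
    exact ⟨f, h0, fun x hx c hc hfc _ => h x hx c hc hfc⟩
  · exact ⟨1, by simp, fun x _ c _ _ hr' => absurd hr' hr⟩

theorem mono (hp : NearGeneric coord V c₀ p) (h : ∀ x ∈ V, p x → q x) :
    NearGeneric coord V c₀ q := by
  obtain ⟨f, h0, hf⟩ := hp
  exact ⟨f, h0, fun x hx c hc hfc => h x hx (hf x hx c hc hfc)⟩

end NearGeneric

theorem Generic.mono {E σ : Type} {coord : E → (σ → ℂ) → Prop} {V : Set E} {p q : E → Prop}
    (hp : Generic coord V p) (h : ∀ x ∈ V, p x → q x) : Generic coord V q := by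
  obtain ⟨f, h0, hf⟩ := hp
  exact ⟨f, h0, fun x hx c hc hfc => h x hx (hf x hx c hc hfc)⟩

theorem exists_isFrame {k n : ℕ} (W : Grass k n) : ∃ F, IsFrame W F := by
  let b := Module.finBasisOfFinrankEq ℂ W.1 W.2
  refine ⟨fun a => (b a : Fin n → ℂ), ?_⟩
  have h := congrArg (Submodule.map W.1.subtype) b.span_eq
  rw [Submodule.map_span, ← Set.range_comp, Submodule.map_top, Submodule.range_subtype] at h
  exact h

theorem IsFrame.linearIndependent {k n : ℕ} {W : Grass k n} {F : Fin k → Fin n → ℂ}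
    (h : IsFrame W F) : LinearIndependent ℂ F := by
  rw [linearIndependent_iff_card_eq_finrank_span, Set.finrank, h, W.2, Fintype.card_fin]

theorem IsFrame.eq_span_singleton {n : ℕ} {W : Grass 1 n} {F : Fin 1 → Fin n → ℂ}
    (h : IsFrame W F) : W.1 = Submodule.span ℂ {F 0} := by
  rw [← h]
  congr 1
  ext x
  simp [eq_comm]

theorem IsFrame.eq_span_pair {n : ℕ} {W : Grass 2 n} {F : Fin 2 → Fin n → ℂ}
    (h : IsFrame W F) : W.1 = Submodule.span ℂ {F 0, F 1} := by
  rw [← h]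
  congr 1
  ext x
  simp [eq_comm]

/-- Makes avoidance of an epipole by an image line a polynomial condition on the coordinates;
`exists_minor_ne_zero` does the same for image points. -/
theorem IsFrame.notMem_iff_det_ne_zero {W : Grass 2 3} {F : Fin 2 → Fin 3 → ℂ}
    (h : IsFrame W F) (e : Fin 3 → ℂ) :
    e ∉ W.1 ↔ (Matrix.of (Fin.cons (α := fun _ => Fin 3 → ℂ) e F)).det ≠ 0 := by
  have h1 := linearIndependent_finCons (K := ℂ) (x := e) (v := F)
  rw [h] at h1
  rw [← isUnit_iff_ne_zero, ← Matrix.isUnit_iff_isUnit_det,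
    ← Matrix.linearIndependent_rows_iff_isUnit]
  exact ⟨fun h' => h1.2 ⟨h.linearIndependent, h'⟩, fun h' => (h1.1 h').2⟩

theorem exists_minor_ne_zero {n : ℕ} {x e : Fin n → ℂ} (hx : x ≠ 0)
    (he : e ∉ Submodule.span ℂ {x}) : ∃ a b, x a * e b - x b * e a ≠ 0 := by
  by_contra! h
  obtain ⟨a, ha⟩ := Function.ne_iff.1 hx
  apply he
  rw [Submodule.mem_span_singleton]
  refine ⟨e a / x a, funext fun b => ?_⟩
  have h1 := h a b
  have ha' : x a ≠ 0 := ha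
  simp only [Pi.smul_apply, smul_eq_mul]
  field_simp
  linear_combination -h1

theorem pair_independent_of_minor {n : ℕ} {x y : Fin n → ℂ} {i j : Fin n}
    (h : x i * y j - x j * y i ≠ 0) (a b : ℂ) (hab : a • x + b • y = 0) : a = 0 ∧ b = 0 := by
  have hi := congrFun hab i
  have hj := congrFun hab j
  simp only [Pi.add_apply, Pi.smul_apply, smul_eq_mul, Pi.zero_apply] at hi hj
  constructor
  · apply (mul_eq_zero.1 (?_ : a * (x i * y j - x j * y i) = 0)).resolve_right h
    linear_combination y j * hi - y i * hj
  · apply (mul_eq_zero.1 (?_ : b * (x i * y j - x j * y i) = 0)).resolve_right h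
    linear_combination x i * hj - x j * hi

theorem notMem_span_of_minor {n : ℕ} {x y : Fin n → ℂ} {i j : Fin n}
    (h : x i * y j - x j * y i ≠ 0) : y ∉ Submodule.span ℂ {x} := by
  rw [Submodule.mem_span_singleton]
  rintro ⟨a, rfl⟩
  apply h
  simp
  ring

/-! ### Scenes in general position -/

/-- The cameras have distinct centres and their centres are not on the lines joining another centre
to a point of the arrangement, nor on the lines of the arrangement. -/
structure IsGoodScene {ι κ : Type} (A : Arrangement ι κ) (P : Cameras) : Prop where
  epipole_ne_zero : ∀ v u, v ≠ u → epipole (P v) (P u) ≠ 0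
  pt_mulVec : ∀ i v, ∀ x ∈ (A.pt i).1, P v *ᵥ x = 0 → x = 0
  ln_mulVec : ∀ j v, ∀ x ∈ (A.ln j).1, P v *ᵥ x = 0 → x = 0
  epipole_notMem : ∀ i v u, v ≠ u → epipole (P v) (P u) ∉ (A.pt i).1.map (toLin' (P v))

/-- Three translated cameras. -/
def translatedCameras : Cameras :=
  ![!![1, 0, 0, 0; 0, 1, 0, 0; 0, 0, 1, 0],
    !![1, 0, 0, 1; 0, 1, 0, 0; 0, 0, 1, 0],
    !![1, 0, 0, 2; 0, 1, 0, 1; 0, 0, 1, 0]]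

theorem rot_translatedCameras (v : View) : rot (translatedCameras v) = 1 := by
  ext a b
  fin_cases v <;> fin_cases a <;> fin_cases b <;> simp [rot, translatedCameras]

theorem translatedCameras_mem : translatedCameras ∈ cams := by
  refine ⟨fun v => by simp [rot_translatedCameras], rot_translatedCameras 0, ?_, ?_⟩
  · ext a
    fin_cases a <;> simp [transl, translatedCameras]
  · simp [transl, translatedCameras]

theorem epipole_eq (P P' : Matrix (Fin 3) (Fin 4) ℂ) :
    epipole P P' = transl P - rot P *ᵥ ((rot P')ᵀ *ᵥ transl P') := by
  rw [epipole, center, mulVec_snoc, mulVec_neg, one_smul]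
  abel

theorem epipole_translatedCameras (v u : View) :
    epipole (translatedCameras v) (translatedCameras u) =
      transl (translatedCameras v) - transl (translatedCameras u) := by
  rw [epipole_eq, rot_translatedCameras, rot_translatedCameras]
  simp

theorem isPolynomial_epipole {σ : Type} {M M' : (σ → ℂ) → Matrix (Fin 3) (Fin 4) ℂ}
    (hM : ∀ a b, IsPolynomial fun c => M c a b) (hM' : ∀ a b, IsPolynomial fun c => M' c a b)
    (a : Fin 3) : IsPolynomial fun c => epipole (M c) (M' c) a := by
  simp only [epipole_eq, Pi.sub_apply]
  exact (hM _ _).sub (.mulVec (fun a b => hM _ _)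
    (.mulVec (fun a b => hM' _ _) fun b => hM' _ _) _)

theorem generic_isGoodScene {ι κ : Type} [Finite ι] [Finite κ] (Q : PointLineProblem ι κ) :
    Generic sceneCoord Q.scenes fun S => IsGoodScene S.1 S.2 := by
  -- One point and one line through it serve for all labels, so every incidence holds. Both vectors
  -- end in 0, so the translated cameras all see them alike; the epipoles are the differences of
  -- translations, none of which is proportional to (1, 3, 0).
  let x₀ : Fin 4 → ℂ := ![1, 3, 0, 0]
  let y₀ : Fin 4 → ℂ := ![0, 1, 0, 0]
  let c₀ : (ι × Fin 1 × Fin 4) ⊕ (κ × Fin 2 × Fin 4) ⊕ (View × Fin 3 × Fin 4) → ℂ :=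
    Sum.elim (fun s => x₀ s.2.2) (Sum.elim (fun s => ![x₀, y₀] s.2.1 s.2.2)
      fun s => translatedCameras s.1 s.2.1 s.2.2)
  have hx₀ : x₀ ≠ 0 := fun h => by simpa [x₀] using congrFun h 0
  have hxy : Module.finrank ℂ (Submodule.span ℂ {x₀, y₀}) = 2 :=
    finrank_span_pair (pair_independent_of_minor (i := 0) (j := 1) (by simp [x₀, y₀]))
  let A₀ : Arrangement ι κ :=
    ⟨fun _ => ⟨_, finrank_span_singleton hx₀⟩, fun _ => ⟨_, hxy⟩⟩
  have hA₀ : (A₀, translatedCameras) ∈ Q.scenes :=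
    ⟨fun i j _ => Submodule.span_mono (by simp), translatedCameras_mem⟩
  have hc₀ : sceneCoord (A₀, translatedCameras) c₀ := by
    refine ⟨fun i => ?_, fun j => ?_, fun v a b => rfl⟩
    · change Submodule.span ℂ (Set.range fun _ : Fin 1 => x₀) = Submodule.span ℂ {x₀}
      rw [Set.range_const]
    · change Submodule.span ℂ (Set.range ![x₀, y₀]) = Submodule.span ℂ {x₀, y₀}
      rw [Matrix.range_cons_cons_empty]
  have hcam (v : View) (a : Fin 3) (b : Fin 4) : IsPolynomial
      fun c : (ι × Fin 1 × Fin 4) ⊕ (κ × Fin 2 × Fin 4) ⊕ (View × Fin 3 × Fin 4) → ℂ =>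
        (Matrix.of fun a b => c (.inr (.inr (v, a, b))) : Matrix (Fin 3) (Fin 4) ℂ) a b :=
    .coord _
  have hcam' {S : Arrangement ι κ × Cameras} {c} (hc : sceneCoord S c) (v : View) :
      S.2 v = Matrix.of fun a b => c (.inr (.inr (v, a, b))) := by
    ext a b
    exact hc.2.2 v a b
  have h1 (v u : View) (hvu : v ≠ u) : NearGeneric sceneCoord Q.scenes c₀ fun S =>
      epipole (S.2 v) (S.2 u) ≠ 0 := by
    refine .of_isPolynomial (isPolynomial_epipole (hcam v) (hcam u) 0) ?_ fun S _ c hc h0 => ?_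
    · rw [← hcam' hc₀, ← hcam' hc₀, epipole_translatedCameras]
      revert hvu
      fin_cases v <;> fin_cases u <;> simp [transl, translatedCameras] <;> norm_num
    · rw [← hcam' hc, ← hcam' hc] at h0
      exact fun h => h0 (by rw [h]; rfl)
  have h2 (j : κ) (v : View) : NearGeneric sceneCoord Q.scenes c₀ fun S =>
      ∀ x ∈ (S.1.ln j).1, S.2 v *ᵥ x = 0 → x = 0 := by
    have hp (k : Fin 2) (a : Fin 3) := IsPolynomial.mulVec (hcam v)
      (w := fun c b => c (.inr (.inl (j, k, b)))) (fun b => .coord _) a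
    refine .of_isPolynomial (((hp 0 0).mul (hp 1 1)).sub ((hp 0 1).mul (hp 1 0))) ?_
      fun S _ c hc h0 x hx hPx => ?_
    · simp only [← hcam' hc₀]
      fin_cases v <;> simp [c₀, x₀, y₀, translatedCameras, Matrix.mulVec, dotProduct,
        Fin.sum_univ_succ]
    · simp only [← hcam' hc] at h0
      rw [(hc.2.1 j).eq_span_pair, Submodule.mem_span_pair] at hx
      obtain ⟨a, b, rfl⟩ := hx
      rw [mulVec_add, mulVec_smul, mulVec_smul] at hPx
      obtain ⟨rfl, rfl⟩ := pair_independent_of_minor h0 a b hPx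
      simp
  have h3 (i : ι) (v u : View) (hvu : v ≠ u) : NearGeneric sceneCoord Q.scenes c₀ fun S =>
      epipole (S.2 v) (S.2 u) ∉ (S.1.pt i).1.map (toLin' (S.2 v)) ∧
      ∀ x ∈ (S.1.pt i).1, S.2 v *ᵥ x = 0 → x = 0 := by
    have hp (a : Fin 3) := IsPolynomial.mulVec (hcam v)
      (w := fun c b => c (.inl (i, 0, b))) (fun b => .coord _) a
    have he := isPolynomial_epipole (hcam v) (hcam u)
    refine .of_isPolynomial (((hp 0).mul (he 1)).sub ((hp 1).mul (he 0))) ?_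
      fun S _ c hc h0 => ?_
    · simp only [← hcam' hc₀, epipole_translatedCameras]
      revert hvu
      fin_cases v <;> fin_cases u <;>
        simp [c₀, x₀, transl, translatedCameras, Matrix.mulVec, dotProduct,
        Fin.sum_univ_succ] <;> norm_num
    · simp only [← hcam' hc] at h0
      rw [(hc.1 i).eq_span_singleton, map_span_singleton]
      refine ⟨notMem_span_of_minor h0, fun x hx hPx => ?_⟩
      rw [Submodule.mem_span_singleton] at hx
      obtain ⟨a, rfl⟩ := hx
      rw [mulVec_smul] at hPx
      obtain ⟨rfl, -⟩ := pair_independent_of_minor h0 a 0 (by rw [hPx]; simp)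
      simp
  refine ((NearGeneric.forall_finite fun v => .forall_finite fun u => .imp (h1 v u)).and
    ((NearGeneric.forall_finite fun j => .forall_finite (h2 j)).and
    (NearGeneric.forall_finite fun i => .forall_finite fun v => .forall_finite fun u =>
      .imp (h3 i v u))) |>.mono fun S _ h => ?_).generic hA₀ hc₀
  obtain ⟨h1, h2, h3⟩ := h
  refine ⟨h1, fun i v => ?_, h2, fun i v u hvu => (h3 i v u hvu).1⟩
  obtain ⟨u, hu⟩ := exists_ne v
  exact (h3 i v u hu.symm).2

/-! ### Joint images in general position -/

/-- The image points outside `S` and the image lines outside `T` avoid the epipoles. -/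
structure IsGoodImage {ι κ : Type} {Q : PointLineProblem ι κ} (S : Set ι) (T : Set κ) (P : Cameras)
    (y : JointImage Q) : Prop where
  pt : ∀ v (i : Q.obsPt v), i.1 ∉ S → ∀ u, v ≠ u → epipole (P v) (P u) ∉ (y.pt v i).1
  ln : ∀ v (j : Q.obsLn v), j.1 ∉ T → ∀ u, v ≠ u → epipole (P v) (P u) ∉ (y.ln v j).1

theorem exists_imageCoord {ι κ : Type} {Q : PointLineProblem ι κ} (y : JointImage Q) :
    ∃ c, imageCoord y c := by
  choose F hF using fun v i => exists_isFrame (y.pt v i)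
  choose G hG using fun v j => exists_isFrame (y.ln v j)
  exact ⟨Sum.elim (fun s => F s.1 s.2.1 s.2.2.1 s.2.2.2) fun s => G s.1 s.2.1 s.2.2.1 s.2.2.2,
    hF, hG⟩

/-- With the cameras fixed the epipoles are constants, and avoiding them is the non-vanishing of
minors or determinants in the image coordinates. One good image in `V` is therefore enough. -/
theorem generic_isGoodImage {ι κ : Type} [Finite ι] [Finite κ] {Q : PointLineProblem ι κ}
    {S : Set ι} {T : Set κ} {P : Cameras} {V : Set (JointImage Q)} {y₀ : JointImage Q}
    (hV : y₀ ∈ V) (hy₀ : IsGoodImage S T P y₀) : Generic imageCoord V (IsGoodImage S T P) := by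
  obtain ⟨c₀, hc₀⟩ := exists_imageCoord y₀
  have h1 (v : View) (i : Q.obsPt v) (hi : i.1 ∉ S) (u : View) (hvu : v ≠ u) :
      NearGeneric imageCoord V c₀ fun y => epipole (P v) (P u) ∉ (y.pt v i).1 := by
    have h := hy₀.pt v i hi u hvu
    rw [(hc₀.1 v i).eq_span_singleton] at h
    obtain ⟨a, b, hab⟩ := exists_minor_ne_zero ((hc₀.1 v i).linearIndependent.ne_zero 0) h
    have hp (a b) : IsPolynomial fun c : (Σ v : View, Q.obsPt v × Fin 1 × Fin 3) ⊕
        (Σ v : View, Q.obsLn v × Fin 2 × Fin 3) → ℂ =>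
        c (.inl ⟨v, i, 0, a⟩) * epipole (P v) (P u) b := .mul (.coord _) (.const _)
    refine .of_isPolynomial ((hp a b).sub (hp b a)) hab fun y _ c hc h0 => ?_
    rw [(hc.1 v i).eq_span_singleton]
    exact notMem_span_of_minor h0
  have h2 (v : View) (j : Q.obsLn v) (hj : j.1 ∉ T) (u : View) (hvu : v ≠ u) :
      NearGeneric imageCoord V c₀ fun y => epipole (P v) (P u) ∉ (y.ln v j).1 := by
    have h := hy₀.ln v j hj u hvu
    rw [(hc₀.2 v j).notMem_iff_det_ne_zero] at h
    have hp (a b : Fin 3) : IsPolynomial fun c : (Σ v : View, Q.obsPt v × Fin 1 × Fin 3) ⊕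
        (Σ v : View, Q.obsLn v × Fin 2 × Fin 3) → ℂ =>
        Matrix.of (Fin.cons (α := fun _ => Fin 3 → ℂ) (epipole (P v) (P u))
          fun a b => c (.inr ⟨v, j, a, b⟩)) a b := by
      refine Fin.cases ?_ (fun a => ?_) a
      · exact .const _
      · exact .coord _
    exact .of_isPolynomial (.det hp) h
      fun y _ c hc h0 => ((hc.2 v j).notMem_iff_det_ne_zero _).2 h0
  refine ((NearGeneric.forall_finite fun v => .forall_finite fun i => .imp fun hi =>
    .forall_finite fun u => .imp (h1 v i hi u)).and
    (NearGeneric.forall_finite fun v => .forall_finite fun i => .imp fun hi =>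
    .forall_finite fun u => .imp (h2 v i hi u)) |>.mono fun y _ h => ⟨h.1, h.2⟩).generic hV hc₀

/-! ### Reducibility -/

/-- The image of a subspace on which a camera is injective. -/
theorem finrank_map_of_mulVec {k : ℕ} (P : Matrix (Fin 3) (Fin 4) ℂ) (W : Grass k 4)
    (h : ∀ x ∈ W.1, P *ᵥ x = 0 → x = 0) : Module.finrank ℂ (W.1.map (toLin' P)) = k := by
  rw [← LinearMap.range_domRestrict, LinearMap.finrank_range_of_inj, W.2]
  rw [← LinearMap.ker_eq_bot, LinearMap.ker_eq_bot']
  rintro ⟨x, hx⟩ hPx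
  exact Subtype.ext (h x hx (by simpa using hPx))

theorem exists_forall_ne_imp_notMem {n : ℕ} (e : View → View → Fin n → ℂ) (v : View)
    {p : Submodule ℂ (Fin n → ℂ) → Prop}
    (h : ∃ W, p W ∧ e v (v + 1) ∉ W ∧ e v (v + 2) ∉ W) :
    ∃ W, p W ∧ ∀ u, v ≠ u → e v u ∉ W := by
  obtain ⟨W, hW, h1, h2⟩ := h
  refine ⟨W, hW, fun u hu => ?_⟩
  have : u = v + 1 ∨ u = v + 2 := by
    revert hu
    clear * -
    revert u v
    decide
  rcases this with rfl | rfl <;> assumption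

namespace PointLineProblem

variable {ι κ : Type} {Q : PointLineProblem ι κ}

/-- Provides the witness for genericity in the fibre over a good scene. Kept features are projected.
A forgotten point is placed on the image of its only kept pin, if there is one; then a forgotten
line is drawn through its point, if it has one. -/
theorem exists_isGoodImage (hPL1P : Q.IsPL1P) {S : Set ι} {T : Set κ}
    (hST : ∀ i, i ∉ S → (Q.pins i ∩ T).Subsingleton) {A : Arrangement S T} {P : Cameras}
    (hA : A ∈ (Q.restrict S T).arrangements) (hgood : IsGoodScene A P) :
    ∃ y : JointImage Q, (y ∈ Q.images ∧ (Q.restrict S T).Projects A P (y.restrict S T)) ∧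
      IsGoodImage S T P y := by
  have hne (v : View) : v ≠ v + 1 ∧ v ≠ v + 2 := by
    revert v
    decide
  have hpt (v : View) (i : ι) : ∃ W : Grass 1 3,
      ((∀ h : i ∈ S, (A.pt ⟨i, h⟩).1.map (toLin' (P v)) = W.1) ∧
        ∀ j (hj : j ∈ T), (i, j) ∈ Q.inc → W.1 ≤ (A.ln ⟨j, hj⟩).1.map (toLin' (P v))) ∧
      ∀ u, v ≠ u → epipole (P v) (P u) ∉ W.1 := by
    by_cases hi : i ∈ S
    · refine ⟨⟨_, finrank_map_of_mulVec (P v) _ (hgood.pt_mulVec ⟨i, hi⟩ v)⟩,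
        ⟨fun _ => rfl, fun j hj hij => Submodule.map_mono (hA ⟨i, hi⟩ ⟨j, hj⟩ hij)⟩,
        hgood.epipole_notMem ⟨i, hi⟩ v⟩
    -- `V` is the locus allowed for the image point: a line if one pin is kept, else the whole
    -- plane. Two kept pins would pin the point down, which `hST` rules out.
    · have : ∃ V : Submodule ℂ (Fin 3 → ℂ), 2 ≤ Module.finrank ℂ V ∧
          ∀ j (hj : j ∈ T), (i, j) ∈ Q.inc → V ≤ (A.ln ⟨j, hj⟩).1.map (toLin' (P v)) := by
        by_cases h : ∃ j, j ∈ Q.pins i ∩ T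
        · obtain ⟨j, hj⟩ := h
          refine ⟨(A.ln ⟨j, hj.2⟩).1.map (toLin' (P v)),
            (finrank_map_of_mulVec (P v) _ (hgood.ln_mulVec ⟨j, hj.2⟩ v)).ge,
            fun j' hj' hij' => ?_⟩
          obtain rfl := hST i hi hj ⟨hij', hj'⟩
          exact le_rfl
        · exact ⟨⊤, by simp, fun j hj hij => absurd ⟨j, hij, hj⟩ h⟩
      obtain ⟨V, hV, hV'⟩ := this
      obtain ⟨x, hx, h1, h2⟩ := exists_point_avoiding hV
        (hgood.epipole_ne_zero v _ (hne v).1) (hgood.epipole_ne_zero v _ (hne v).2)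
      obtain ⟨W, ⟨⟨hW1, hW2⟩, hW⟩⟩ := exists_forall_ne_imp_notMem
        (fun v u => epipole (P v) (P u)) v
        (p := fun W => Module.finrank ℂ W = 1 ∧ W ≤ V) ⟨x.1, ⟨x.2, hx⟩, h1, h2⟩
      exact ⟨⟨W, hW1⟩, ⟨fun h => absurd h hi, fun j hj hij => hW2.trans (hV' j hj hij)⟩, hW⟩
  choose pt hpt hpt' using hpt
  have hln (v : View) (j : κ) : ∃ W : Grass 2 3,
      (∀ h : j ∈ T, (A.ln ⟨j, h⟩).1.map (toLin' (P v)) = W.1) ∧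
      (∀ i, (i, j) ∈ Q.inc → (pt v i).1 ≤ W.1) ∧
      (j ∉ T → ∀ u, v ≠ u → epipole (P v) (P u) ∉ W.1) := by
    by_cases hj : j ∈ T
    · exact ⟨⟨_, finrank_map_of_mulVec (P v) _ (hgood.ln_mulVec ⟨j, hj⟩ v)⟩, fun _ => rfl,
        fun i hij => (hpt v i).2 j hj hij, fun h => absurd hj h⟩
    · have : ∃ W : Grass 1 3, (∀ i, (i, j) ∈ Q.inc → (pt v i).1 ≤ W.1) ∧
          ∀ u, v ≠ u → epipole (P v) (P u) ∉ W.1 := by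
        by_cases h : ∃ i, (i, j) ∈ Q.inc
        · obtain ⟨i, hi⟩ := h
          refine ⟨pt v i, fun i' hi' => ?_, hpt' v i⟩
          obtain rfl := hPL1P j hi hi'
          exact le_rfl
        · obtain ⟨x, -, h1, h2⟩ := exists_point_avoiding (W := ⊤) (n := 3) (by simp)
            (hgood.epipole_ne_zero v _ (hne v).1) (hgood.epipole_ne_zero v _ (hne v).2)
          obtain ⟨W, hW1, hW⟩ := exists_forall_ne_imp_notMem
            (fun v u => epipole (P v) (P u)) v
            (p := fun W => Module.finrank ℂ W = 1) ⟨x.1, x.2, h1, h2⟩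
          exact ⟨⟨W, hW1⟩, fun i hi => absurd ⟨i, hi⟩ h, hW⟩
      obtain ⟨x, hx, hx'⟩ := this
      obtain ⟨ℓ, hℓ, h1, h2⟩ := exists_line_avoiding x (hx' _ (hne v).1) (hx' _ (hne v).2)
      obtain ⟨W, ⟨⟨hW1, hW2⟩, hW⟩⟩ := exists_forall_ne_imp_notMem
        (fun v u => epipole (P v) (P u)) v
        (p := fun W => Module.finrank ℂ W = 2 ∧ x.1 ≤ W) ⟨ℓ.1, ⟨ℓ.2, hℓ⟩, h1, h2⟩
      exact ⟨⟨W, hW1⟩, fun h => absurd h hj, fun i hi => (hx i hi).trans hW2, fun _ => hW⟩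
  choose ln hln hln' hln'' using hln
  exact ⟨⟨fun v i => pt v i, fun v j => ln v j⟩, ⟨fun v i j hij => hln' v j i hij,
    fun v i => (hpt v i.1.1).1 i.1.2, fun v j => hln v j.1.1 j.1.2⟩,
    fun v i _ => hpt' v i, fun v j hj => hln'' v j hj⟩

/-- A criterion for reducibility: scenes and images may be assumed to be in general position. The
forgotten points have to be found on the lines that are kept, then the forgotten lines. -/
theorem reducibleTo_of_lift [Finite ι] [Finite κ] (hPL1P : Q.IsPL1P) {S : Set ι} {T : Set κ}
    (hST : ∀ i, i ∉ S → (Q.pins i ∩ T).Subsingleton)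
    (hlift : ∀ (A : Arrangement S T) (P : Cameras) (y : JointImage Q),
      (∀ v, IsCalibrated (P v)) → IsGoodScene A P → y ∈ Q.images →
      (Q.restrict S T).Projects A P (y.restrict S T) → IsGoodImage S T P y →
      ∃ X : ι → Grass 1 4, (∀ i : S, X i = A.pt i) ∧
        (∀ i, i ∉ S → (∀ v (hv : i ∈ Q.obsPt v),
          (X i).1.map (toLin' (P v)) = (y.pt v ⟨i, hv⟩).1) ∧
          ∀ j : T, (i, j.1) ∈ Q.inc → (X i).1 ≤ (A.ln j).1) ∧
        ∀ j, j ∉ T → ∃ L : Grass 2 4, (∀ i, (i, j) ∈ Q.inc → (X i).1 ≤ L.1) ∧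
          ∀ v (hv : j ∈ Q.obsLn v), L.1.map (toLin' (P v)) = (y.ln v ⟨j, hv⟩).1) :
    Q.ReducibleTo S T := by
  refine ⟨hST, (generic_isGoodScene (Q.restrict S T)).mono fun ⟨A, P⟩ ⟨hA, hP⟩ hgood => ?_⟩
  obtain ⟨y₀, hy₀, hy₀'⟩ := exists_isGoodImage hPL1P hST hA hgood
  refine (generic_isGoodImage
    (V := {y | y ∈ Q.images ∧ (Q.restrict S T).Projects A P (y.restrict S T)})
    hy₀ hy₀').mono fun y ⟨hy, hproj⟩ hy' => ?_
  obtain ⟨X, hX, hX', hL⟩ := hlift A P y (isCalibrated_of_mem_cams hP) hgood hy hproj hy'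
  have hL' (j : κ) : ∃ L : Grass 2 4, (∀ h : j ∈ T, L = A.ln ⟨j, h⟩) ∧
      (∀ i, (i, j) ∈ Q.inc → (X i).1 ≤ L.1) ∧
      ∀ v (hv : j ∈ Q.obsLn v), L.1.map (toLin' (P v)) = (y.ln v ⟨j, hv⟩).1 := by
    by_cases hj : j ∈ T
    · refine ⟨A.ln ⟨j, hj⟩, fun _ => rfl, fun i hij => ?_, fun v hv => hproj.2 v ⟨⟨j, hj⟩, hv⟩⟩
      by_cases hi : i ∈ S
      · rw [hX ⟨i, hi⟩]
        exact hA ⟨i, hi⟩ ⟨j, hj⟩ hij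
      · exact (hX' i hi).2 ⟨j, hj⟩ hij
    · obtain ⟨L, h1, h2⟩ := hL j hj
      exact ⟨L, fun h => absurd h hj, h1, h2⟩
  choose L hL1 hL2 hL3 using hL'
  refine ⟨⟨X, L⟩, fun i j hij => hL2 j i hij, ⟨fun v i => ?_, fun v j => hL3 j v j.2⟩, ?_⟩
  · by_cases hi : i.1 ∈ S
    · have := hproj.1 v ⟨⟨i, hi⟩, i.2⟩
      rw [← hX] at this
      exact this
    · exact (hX' i hi).1 v i.2
  · change Arrangement.mk _ _ = A
    cases A
    congr 1
    · exact funext hX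
    · exact funext fun j => hL1 j j.2

end PointLineProblem

theorem exists_line_avoiding_epipoles {ι κ : Type} {A : Arrangement ι κ} {P : Cameras}
    (h : IsGoodScene A P) (v : View) :
    ∃ ℓ : Grass 2 3, ∀ u, v ≠ u → epipole (P v) (P u) ∉ ℓ.1 := by
  have hne : v ≠ v + 1 ∧ v ≠ v + 2 := by
    revert v
    decide
  obtain ⟨x, -, h1, h2⟩ := exists_point_avoiding (W := ⊤) (n := 3) (by simp)
    (h.epipole_ne_zero v _ hne.1) (h.epipole_ne_zero v _ hne.2)
  obtain ⟨ℓ, -, h1, h2⟩ := exists_line_avoiding x h1 h2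
  obtain ⟨W, hW, hW'⟩ := exists_forall_ne_imp_notMem (fun v u => epipole (P v) (P u)) v
    (p := fun W => Module.finrank ℂ W = 2) ⟨ℓ.1, ℓ.2, h1, h2⟩
  exact ⟨⟨W, hW⟩, hW'⟩

/-- A point of a subspace that is seen at a given place. -/
theorem exists_point_of_le_map {P : Matrix (Fin 3) (Fin 4) ℂ} {W : Submodule ℂ (Fin 4 → ℂ)}
    {x : Grass 1 3} (h : x.1 ≤ W.map (toLin' P)) :
    ∃ X : Grass 1 4, X.1 ≤ W ∧ X.1.map (toLin' P) = x.1 := by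
  obtain ⟨p, hp, hp0⟩ := exists_ne_zero_of_finrank (W := x.1) (by rw [x.2]; simp)
  obtain ⟨ξ, hξ, rfl⟩ := h hp
  rw [toLin'_apply] at hp hp0
  refine ⟨⟨Submodule.span ℂ {ξ}, finrank_span_singleton ?_⟩, by simpa using hξ, ?_⟩
  · rintro rfl
    simp at hp0
  · rw [map_span_singleton]
    exact span_singleton_eq_of_mem x.2 hp hp0

theorem map_toLin'_eq_top {P : Matrix (Fin 3) (Fin 4) ℂ} (hP : IsCalibrated P) :
    (⊤ : Submodule ℂ (Fin 4 → ℂ)).map (toLin' P) = ⊤ := by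
  rw [eq_top_iff]
  intro p _
  obtain ⟨z, rfl⟩ := exists_mulVec_eq hP p
  exact ⟨z, trivial, by simp⟩

namespace PointLineProblem

variable {ι κ : Type} {Q : PointLineProblem ι κ}

/-- A forgotten line which is seen by at most two views is recovered from one of its points. -/
theorem exists_line_through {S : Set ι} {T : Set κ} {P : Cameras} (hP : ∀ v, IsCalibrated (P v))
    {y : JointImage Q} (hy : IsGoodImage S T P y) {j : κ} (hj : j ∉ T)
    (hV : Q.viewsLn j ≠ Set.univ) (X : Grass 1 4)
    (hX : ∀ v (hv : j ∈ Q.obsLn v), X.1.map (toLin' (P v)) ≤ (y.ln v ⟨j, hv⟩).1 ∧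
      ∀ x ∈ X.1, P v *ᵥ x = 0 → x = 0) :
    ∃ L : Grass 2 4, X.1 ≤ L.1 ∧
      ∀ v (hv : j ∈ Q.obsLn v), L.1.map (toLin' (P v)) = (y.ln v ⟨j, hv⟩).1 := by
  obtain ⟨ξ, hξ, hξ0⟩ := exists_ne_zero_of_finrank (W := X.1) (by rw [X.2]; simp)
  obtain ⟨L, hL, hL'⟩ := exists_line_of_views hP hV (fun v => y.ln v.1 ⟨j, v.2⟩)
    (fun v u hvu => hy.ln v.1 ⟨j, v.2⟩ hj u hvu) hξ0 (fun v =>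
      ⟨(hX v.1 v.2).1 ⟨ξ, hξ, by simp⟩, fun h => hξ0 ((hX v.1 v.2).2 ξ hξ h)⟩)
  refine ⟨L, ?_, fun v hv => hL' ⟨v, hv⟩⟩
  rwa [← span_singleton_eq_of_mem X.2 hξ hξ0, Submodule.span_singleton_le_iff_mem]

/-- A point in space whose images in some of the views are on given lines. -/
theorem exists_point_seen_on_lines {S : Set ι} {T : Set κ} {A : Arrangement S T} {P : Cameras}
    (hP : ∀ v, IsCalibrated (P v)) (hA : IsGoodScene A P) {V : Set View} (ℓ : V → Grass 2 3)
    (hℓ : ∀ (v : V) u, v.1 ≠ u → epipole (P v) (P u) ∉ (ℓ v).1) :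
    ∃ X : Grass 1 4, ∀ v : V, X.1.map (toLin' (P v)) ≤ (ℓ v).1 ∧
      ∀ x ∈ X.1, P v *ᵥ x = 0 → x = 0 := by
  -- Views outside `V` receive an arbitrary auxiliary line that avoids the epipoles, so that three
  -- lines are available.
  have (v : View) : ∃ m : Grass 2 3, (∀ hv : v ∈ V, m = ℓ ⟨v, hv⟩) ∧
      ∀ u, v ≠ u → epipole (P v) (P u) ∉ m.1 := by
    by_cases hv : v ∈ V
    · exact ⟨ℓ ⟨v, hv⟩, fun _ => rfl, hℓ ⟨v, hv⟩⟩
    · obtain ⟨m, hm⟩ := exists_line_avoiding_epipoles hA v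
      exact ⟨m, fun h => absurd h hv, hm⟩
  choose m hm hm' using this
  obtain ⟨ξ, hξ⟩ := exists_point_of_three_lines hP m hm'
  have hξ0 : ξ ≠ 0 := by
    rintro rfl
    simpa using (hξ 0).2
  refine ⟨⟨_, finrank_span_singleton hξ0⟩, fun v => ⟨?_, fun x hx hPx => ?_⟩⟩
  · rw [map_span_singleton, Submodule.span_singleton_le_iff_mem, ← hm v v.2]
    exact (hξ v).1
  · obtain ⟨a, rfl⟩ := Submodule.mem_span_singleton.1 hx
    rw [mulVec_smul, smul_eq_zero] at hPx
    rw [hPx.resolve_right (hξ v).2, zero_smul]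

/-! ### Reductions that remove the excluded local features -/

variable [Finite ι] [Finite κ]

/-- At most two planes are given, and they always have a common line. -/
theorem reducibleTo_of_freeLine (hPL1P : Q.IsPL1P) {j : κ} (hj : Q.IsFreeLine j)
    (hV : Q.viewsLn j ≠ Set.univ) : Q.ReducibleTo Set.univ {j}ᶜ := by
  refine reducibleTo_of_lift hPL1P (fun i hi => absurd trivial hi)
    fun A P y hP hA hy hproj hy' => ⟨fun i => A.pt ⟨i, trivial⟩, fun i => rfl,
      fun i hi => absurd trivial hi, fun j' hj' => ?_⟩
  obtain rfl : j' = j := by simpa using hj'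
  obtain ⟨X, hX⟩ := exists_point_seen_on_lines hP hA (V := Q.viewsLn j')
    (fun v => y.ln v.1 ⟨j', v.2⟩) (fun v u => hy'.ln v.1 ⟨j', v.2⟩ hj' u)
  obtain ⟨L, -, hL⟩ := exists_line_through hP hy' hj' hV X fun v hv => hX ⟨v, hv⟩
  exact ⟨L, fun i hij => absurd hij (hj i), hL⟩

/-- Every view of the pin also sees the point on it, so the one or two back-projected planes contain
the kept point and share a line through it. -/
theorem reducibleTo_of_pin (hPL1P : Q.IsPL1P) {i : ι} {j : κ} (hij : (i, j) ∈ Q.inc)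
    (hV : Q.viewsLn j ≠ Set.univ) (hsub : Q.viewsLn j ⊆ Q.viewsPt i) :
    Q.ReducibleTo Set.univ {j}ᶜ := by
  refine reducibleTo_of_lift hPL1P (fun i hi => absurd trivial hi)
    fun A P y hP hA hy hproj hy' => ⟨fun i => A.pt ⟨i, trivial⟩, fun i => rfl,
      fun i hi => absurd trivial hi, fun j' hj' => ?_⟩
  obtain rfl : j' = j := by simpa using hj'
  obtain ⟨L, hL, hL'⟩ := exists_line_through hP hy' hj' hV (A.pt ⟨i, trivial⟩) fun v hv => by
    refine ⟨?_, hA.pt_mulVec _ v⟩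
    have hiv : i ∈ Q.obsPt v := hsub hv
    have := hproj.1 v ⟨⟨i, trivial⟩, hiv⟩
    exact this.le.trans (hy v ⟨i, hiv⟩ ⟨j', hv⟩ hij)
  refine ⟨L, fun i' hi' => ?_, hL'⟩
  obtain rfl := hPL1P j' hij hi'
  exact hL

/-- Reducibility when one point and possibly some of its pins are forgotten. -/
theorem reducibleTo_compl_singleton (hPL1P : Q.IsPL1P) {i : ι} {T : Set κ}
    (hT : ∀ j, j ∉ T → (i, j) ∈ Q.inc) (hiT : (Q.pins i ∩ T).Subsingleton)
    (hlift : ∀ (A : Arrangement ↑({i}ᶜ : Set ι) T) (P : Cameras) (y : JointImage Q),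
      (∀ v, IsCalibrated (P v)) → IsGoodScene A P → y ∈ Q.images →
      (Q.restrict {i}ᶜ T).Projects A P (y.restrict {i}ᶜ T) → IsGoodImage {i}ᶜ T P y →
      ∃ X : Grass 1 4,
        (∀ v (hv : i ∈ Q.obsPt v), X.1.map (toLin' (P v)) = (y.pt v ⟨i, hv⟩).1) ∧
        (∀ j : T, (i, j.1) ∈ Q.inc → X.1 ≤ (A.ln j).1) ∧
        ∀ j, j ∉ T → ∃ L : Grass 2 4, X.1 ≤ L.1 ∧
          ∀ v (hv : j ∈ Q.obsLn v), L.1.map (toLin' (P v)) = (y.ln v ⟨j, hv⟩).1) :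
    Q.ReducibleTo {i}ᶜ T := by
  refine reducibleTo_of_lift hPL1P (fun i' hi' => ?_) fun A P y hP hA hy hproj hy' => ?_
  · obtain rfl : i' = i := by simpa using hi'
    exact hiT
  classical
  obtain ⟨X, h1, h2, h3⟩ := hlift A P y hP hA hy hproj hy'
  refine ⟨fun i' => if h : i' ∈ ({i}ᶜ : Set ι) then A.pt ⟨i', h⟩ else X, fun i' => ?_,
    fun i' hi' => ?_, fun j hj => ?_⟩
  · exact dif_pos i'.2
  · beta_reduce
    rw [dif_neg hi']
    obtain rfl : i' = i := by simpa using hi'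
    exact ⟨h1, h2⟩
  · obtain ⟨L, h4, h5⟩ := h3 j hj
    refine ⟨L, fun i' hi' => ?_, h5⟩
    obtain rfl := hPL1P j (hT j hj) hi'
    beta_reduce
    rwa [dif_neg (by simp)]

/-- Any point of the viewing ray will do, or any point at all if no view sees it. -/
theorem reducibleTo_of_noPins (hPL1P : Q.IsPL1P) {i : ι} (hpins : Q.pins i = ∅)
    (hX : (Q.viewsPt i).Subsingleton) : Q.ReducibleTo {i}ᶜ Set.univ := by
  refine reducibleTo_compl_singleton hPL1P (fun j hj => absurd trivial hj) (by simp [hpins])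
    fun A P y hP hA hy hproj hy' => ?_
  have hno (j) (h : (i, j) ∈ Q.inc) : False := by
    have : j ∈ Q.pins i := h
    rw [hpins] at this
    exact this
  by_cases h : ∃ v, i ∈ Q.obsPt v
  · obtain ⟨v, hv⟩ := h
    obtain ⟨X, -, hX'⟩ := exists_point_of_le_map (P := P v) (W := ⊤) (x := y.pt v ⟨i, hv⟩)
      (by rw [map_toLin'_eq_top (hP v)]; exact le_top)
    refine ⟨X, fun u hu => ?_, fun j hj => (hno _ hj).elim, fun j hj => absurd trivial hj⟩
    obtain rfl := hX hv hu
    exact hX'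
  · exact ⟨⟨Submodule.span ℂ {Pi.single 0 1}, finrank_span_singleton (by simp)⟩,
      fun v hv => absurd ⟨v, hv⟩ h, fun j hj => (hno _ hj).elim, fun j hj => absurd trivial hj⟩

/-- The pin is kept. The image point lies on the image of the pin in the same view and is therefore
the image of a point of the pin. -/
theorem reducibleTo_of_onePin (hPL1P : Q.IsPL1P) {i : ι} {j : κ} (hpins : Q.pins i = {j})
    (hX : (Q.viewsPt i).Subsingleton) (hsub : Q.viewsPt i ⊆ Q.viewsLn j) :
    Q.ReducibleTo {i}ᶜ Set.univ := by
  refine reducibleTo_compl_singleton hPL1P (fun j hj => absurd trivial hj) (by simp [hpins])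
    fun A P y hP hA hy hproj hy' => ?_
  have hj : (i, j) ∈ Q.inc := by
    change j ∈ Q.pins i
    rw [hpins]
    rfl
  have huniq (j' : κ) (h : (i, j') ∈ Q.inc) : j' = j := by
    have : j' ∈ Q.pins i := h
    rwa [hpins] at this
  suffices ∃ X : Grass 1 4,
      (∀ v (hv : i ∈ Q.obsPt v), X.1.map (toLin' (P v)) = (y.pt v ⟨i, hv⟩).1) ∧
        X.1 ≤ (A.ln ⟨j, trivial⟩).1 by
    obtain ⟨X, h1, h2⟩ := this
    refine ⟨X, h1, fun j' hj' => ?_, fun j hj => absurd trivial hj⟩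
    obtain rfl : j' = ⟨j, trivial⟩ := Subtype.ext (huniq _ hj')
    exact h2
  by_cases h : ∃ v, i ∈ Q.obsPt v
  · obtain ⟨v, hv⟩ := h
    have hjv : j ∈ Q.obsLn v := hsub hv
    obtain ⟨X, hXL, hX'⟩ := exists_point_of_le_map (P := P v) (W := (A.ln ⟨j, trivial⟩).1)
      (x := y.pt v ⟨i, hv⟩)
      ((hy v ⟨i, hv⟩ ⟨j, hjv⟩ hj).trans (hproj.2 v ⟨⟨j, trivial⟩, hjv⟩).ge)
    refine ⟨X, fun u hu => ?_, hXL⟩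
    obtain rfl := hX hv hu
    exact hX'
  · obtain ⟨ξ, hξ, hξ0⟩ := exists_ne_zero_of_finrank (W := (A.ln ⟨j, trivial⟩).1)
      (by rw [(A.ln ⟨j, trivial⟩).2]; simp)
    exact ⟨⟨Submodule.span ℂ {ξ}, finrank_span_singleton hξ0⟩,
      fun v hv => absurd ⟨v, hv⟩ h, by simpa using hξ⟩

/-- Point and pin are both forgotten: the ray of the point in view `u` meets the plane of the pin in
view `v`, and the pin is any suitable line of this plane through the meeting point. -/
theorem reducibleTo_of_onePin_of_separate_views (hPL1P : Q.IsPL1P) {i : ι} {j : κ} {u v : View}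
    (hpins : Q.pins i = {j}) (huv : u ≠ v) (hi : Q.viewsPt i = {u}) (hj : Q.viewsLn j = {v}) :
    Q.ReducibleTo {i}ᶜ {j}ᶜ := by
  have hiu : i ∈ Q.obsPt u := by
    change u ∈ Q.viewsPt i
    rw [hi]
    rfl
  have hjv : j ∈ Q.obsLn v := by
    change v ∈ Q.viewsLn j
    rw [hj]
    rfl
  refine reducibleTo_compl_singleton hPL1P (fun j' hj' => ?_) (by simp [hpins])
    fun A P y hP hA hy hproj hy' => ?_
  · obtain rfl : j' = j := by simpa using hj'
    change j' ∈ Q.pins i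
    rw [hpins]
    rfl
  have he := hy'.pt u ⟨i, hiu⟩ (by simp) v huv
  have he' := hy'.ln v ⟨j, hjv⟩ (by simp) u huv.symm
  obtain ⟨p, hp, hp0⟩ := exists_ne_zero_of_finrank (W := (y.pt u ⟨i, hiu⟩).1)
    (by rw [(y.pt u ⟨i, hiu⟩).2]; simp)
  obtain ⟨ξ, rfl, hξ⟩ := exists_mulVec_eq_mulVec_mem (hP u) he' p
  have hξ0 : ξ ≠ 0 := by
    rintro rfl
    simp at hp0
  have hξ' := mulVec_ne_zero_of_notMem (hP v) he hp hp0
  refine ⟨⟨_, finrank_span_singleton hξ0⟩, fun w hw => ?_, fun j' hj' => ?_, fun j' hj' => ?_⟩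
  · obtain rfl : w = u := by
      have : w ∈ Q.viewsPt i := hw
      rwa [hi] at this
    rw [map_span_singleton]
    exact span_singleton_eq_of_mem (y.pt w ⟨i, hiu⟩).2 hp hp0
  · have : j'.1 ∈ Q.pins i := hj'
    rw [hpins] at this
    exact absurd this j'.2
  · obtain rfl : j' = j := by simpa using hj'
    obtain ⟨L, hL, hL'⟩ := exists_line_of_one_view (hP v) hξ hξ'
    refine ⟨L, by simpa using hL, fun w hw => ?_⟩
    obtain rfl : w = v := by
      have : w ∈ Q.viewsLn j' := hw
      rwa [hj] at this
    exact hL'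

/-- The pin `j` is kept. The unseen point is recovered where `j` meets the plane of the dangling pin
`j'`, and `j'` as a line in that plane. -/
theorem reducibleTo_of_twoPins_of_unseen (hPL1P : Q.IsPL1P) {i : ι} {j j' : κ} {v : View}
    (hjj' : j ≠ j') (hpins : Q.pins i = {j, j'}) (hi : Q.viewsPt i = ∅)
    (hj' : Q.viewsLn j' = {v}) : Q.ReducibleTo {i}ᶜ {j'}ᶜ := by
  have hjv : j' ∈ Q.obsLn v := by
    change v ∈ Q.viewsLn j'
    rw [hj']
    rfl
  refine reducibleTo_compl_singleton hPL1P (fun k hk => ?_) ?_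
    fun A P y hP hA hy hproj hy' => ?_
  · obtain rfl : k = j' := by simpa using hk
    change k ∈ Q.pins i
    simp [hpins]
  · rw [hpins]
    rintro k ⟨rfl | rfl, hk⟩ k' ⟨rfl | rfl, hk'⟩ <;> simp_all
  obtain ⟨ξ, hξ, hξ0, hξv⟩ := exists_mem_mulVec_mem (P v) (y.ln v ⟨j', hjv⟩) (A.ln ⟨j, hjj'⟩)
  refine ⟨⟨_, finrank_span_singleton hξ0⟩, fun w hw => ?_, fun k hk => ?_, fun k hk => ?_⟩
  · have : w ∈ Q.viewsPt i := hw
    rw [hi] at this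
    exact this.elim
  · have hk' : k.1 ∈ Q.pins i := hk
    rw [hpins] at hk'
    obtain rfl : k = ⟨j, hjj'⟩ := Subtype.ext (hk'.resolve_right k.2)
    simpa using hξ
  · obtain rfl : k = j' := by simpa using hk
    obtain ⟨L, hL, hL'⟩ := exists_line_of_one_view (hP v) hξv
      fun h => hξ0 (hA.ln_mulVec ⟨j, hjj'⟩ v ξ hξ h)
    refine ⟨L, by simpa using hL, fun w hw => ?_⟩
    obtain rfl : w = v := by
      have : w ∈ Q.viewsLn k := hw
      rwa [hj'] at this
    exact hL'

/-- No view sees two of the pins, since it would then see the point. So there is at most one plane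
per view, and three planes have a common point. -/
theorem reducibleTo_of_dangling_of_unseen (hPL1P : Q.IsPL1P) {i : ι} (hi : Q.viewsPt i = ∅)
    (hpins : ∀ j ∈ Q.pins i, ∃ v, Q.viewsLn j = {v}) : Q.ReducibleTo {i}ᶜ (Q.pins i)ᶜ := by
  have hno (v : View) (h : i ∈ Q.obsPt v) : False := by
    have : v ∈ Q.viewsPt i := h
    rw [hi] at this
    exact this
  refine reducibleTo_compl_singleton hPL1P (fun k hk => not_not.1 hk) (by simp)
    fun A P y hP hA hy hproj hy' => ?_
  -- `k v` is a pin seen in view `v`; it is the only one, as shown below in `hkj`.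
  choose k hk hk' using fun v : {v | ∃ j ∈ Q.pins i, j ∈ Q.obsLn v} => v.2
  obtain ⟨X, hX⟩ := exists_point_seen_on_lines hP hA (fun v => y.ln v.1 ⟨k v, hk' v⟩)
    (fun v u => hy'.ln v.1 ⟨k v, hk' v⟩ (not_not.2 (hk v)) u)
  refine ⟨X, fun w hw => (hno w hw).elim, fun j hj => absurd hj j.2, fun j hj => ?_⟩
  obtain ⟨v, hv⟩ := hpins j (not_not.1 hj)
  refine exists_line_through hP hy' hj (fun h => ?_) X fun w hw => ?_
  · rw [h] at hv
    obtain ⟨u, hu⟩ := exists_ne v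
    exact hu (hv.le trivial)
  · have hkj : k ⟨w, j, not_not.1 hj, hw⟩ = j := by
      by_contra hne
      exact hno w (Q.obs_meet w i _ _ hne (hk ⟨w, j, not_not.1 hj, hw⟩) (not_not.1 hj)
        (hk' ⟨w, j, not_not.1 hj, hw⟩) hw)
    have := hX ⟨w, j, not_not.1 hj, hw⟩
    simp only [hkj] at this
    exact this

end PointLineProblem

/-! ### The tables of local features -/

theorem exists_perm {u v w : View} (huv : u ≠ v) (huw : u ≠ w) (hvw : v ≠ w) :
    ∃ s : Equiv.Perm View, s 0 = u ∧ s 1 = v ∧ s 2 = w := by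
  revert u v w
  decide

theorem exists_third {u v : View} (huv : u ≠ v) :
    ∃ w, u ≠ w ∧ v ≠ w ∧ ∀ x, x = u ∨ x = v ∨ x = w := by
  revert u v
  decide

theorem view_set_ext {u v w : View} (hc : ∀ x, x = u ∨ x = v ∨ x = w) {X Y : Set View}
    (h : (u ∈ X ↔ u ∈ Y) ∧ (v ∈ X ↔ v ∈ Y) ∧ (w ∈ X ↔ w ∈ Y)) : X = Y := by
  ext x
  rcases hc x with rfl | rfl | rfl
  exacts [h.1, h.2.1, h.2.2]

theorem zeroPinsTable_of {X : Set View} (h : ¬ X.Subsingleton) : ZeroPinsTable X := by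
  rw [Set.not_subsingleton_iff] at h
  obtain ⟨u, hu, v, hv, huv⟩ := h
  obtain ⟨w, huw, hvw, hc⟩ := exists_third huv
  by_cases hw : w ∈ X
  · exact .inl (view_set_ext hc (by grind))
  · obtain ⟨s, rfl, rfl, rfl⟩ := exists_perm huv huw hvw
    exact .inr ⟨s, view_set_ext hc (by grind)⟩

/-- The hypotheses exclude `reducibleTo_of_pin`, `reducibleTo_of_onePin` and
`reducibleTo_of_onePin_of_separate_views` in turn. If `X` has at most one view, `h2` gives `X = {u}`
with `u` outside `L`, and `h1`, `h3` force `L` to be the other two. Otherwise `h1` forces `L` to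
contain any view missing from `X`. -/
theorem onePinTable_of {X L : Set View} (h1 : L ≠ Set.univ → ¬ L ⊆ X)
    (h2 : X.Subsingleton → ¬ X ⊆ L) (h3 : ∀ u v, u ≠ v → X = {u} → L ≠ {v}) :
    OnePinTable X L ∨ OnePinDangling X L := by
  by_cases h : X.Subsingleton
  · obtain ⟨u, hu, huL⟩ := Set.not_subset.1 (h2 h)
    have hX : X = {u} := by
      ext x
      exact ⟨fun hx => h hx hu, fun hx => hx ▸ hu⟩
    obtain ⟨v, hv, hvX⟩ := Set.not_subset.1 (h1 fun hL => huL (hL ▸ trivial))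
    have huv : u ≠ v := by grind
    obtain ⟨w, huw, hvw, hc⟩ := exists_third huv
    by_cases hw : w ∈ L
    · obtain ⟨s, rfl, rfl, rfl⟩ := exists_perm huv huw hvw
      exact .inl (.inr ⟨s, .inr (.inr ⟨hX, view_set_ext hc (by grind)⟩)⟩)
    · exact absurd (view_set_ext hc (by grind)) (h3 u v huv hX)
  · rw [Set.not_subsingleton_iff] at h
    obtain ⟨u, hu, v, hv, huv⟩ := h
    obtain ⟨w, huw, hvw, hc⟩ := exists_third huv
    by_cases hw : w ∈ X
    · have hX : X = Set.univ := view_set_ext hc (by grind)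
      subst hX
      exact .inl (.inl ⟨rfl, by_contra fun hL => h1 hL (Set.subset_univ _)⟩)
    · have hX : X = {u, v} := view_set_ext hc (by grind)
      have hwL : w ∈ L := by
        by_contra hwL
        refine h1 (fun hL => hwL (hL ▸ trivial)) fun x hx => ?_
        rcases hc x with rfl | rfl | rfl <;> grind
      by_cases hu' : u ∈ L <;> by_cases hv' : v ∈ L
      · obtain ⟨s, rfl, rfl, rfl⟩ := exists_perm huv huw hvw
        exact .inl (.inr ⟨s, .inl ⟨hX, view_set_ext hc (by grind)⟩⟩)
      · obtain ⟨s, rfl, rfl, rfl⟩ := exists_perm huv.symm hvw huw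
        exact .inl (.inr ⟨s, .inr (.inl ⟨view_set_ext hc (by grind), view_set_ext hc (by grind)⟩)⟩)
      · obtain ⟨s, rfl, rfl, rfl⟩ := exists_perm huv huw hvw
        exact .inl (.inr ⟨s, .inr (.inl ⟨view_set_ext hc (by grind), view_set_ext hc (by grind)⟩)⟩)
      · obtain ⟨s, rfl, rfl, rfl⟩ := exists_perm huv huw hvw
        have hL : L = {s 2} := view_set_ext hc (by grind)
        exact .inr ⟨⟨_, hL⟩, s, hX, hL⟩

theorem not_dangling {u v : View} (huv : u ≠ v) : ¬ Dangling {u, v} := by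
  rintro ⟨w, hw⟩
  have hu : u ∈ ({w} : Set View) := hw ▸ by simp
  have hv : v ∈ ({w} : Set View) := hw ▸ by simp
  exact huv (hu.trans hv.symm)

/-- If `X` is not everything, each pin is seen in a view that misses the point, and by `h2` these
views `v`, `w` are distinct and not shared. Only the third view `u` remains. If the point is seen in
`u`, the four choices for the pins are the listed ones; if not, at most one pin is seen in `u`, so
the other is dangling, against `h3`. -/
theorem twoPinsTable_of {X L L' : Set View} (h1 : L ≠ Set.univ → ¬ L ⊆ X)
    (h1' : L' ≠ Set.univ → ¬ L' ⊆ X) (h2 : L ∩ L' ⊆ X)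
    (h3 : X = ∅ → ¬ Dangling L ∧ ¬ Dangling L') :
    TwoPinsTable X L L' ∨ TwoPinsBothDangling X L L' ∨ TwoPinsOneDangling X L L' ∨
      TwoPinsOneDangling X L' L := by
  by_cases hX : X = Set.univ
  · subst hX
    exact .inl (.inl ⟨rfl, by_contra fun h => h1 h (Set.subset_univ _),
      by_contra fun h => h1' h (Set.subset_univ _)⟩)
  obtain ⟨x, hx⟩ := (Set.ne_univ_iff_exists_notMem X).1 hX
  have hL : ∃ v ∈ L, v ∉ X := by
    by_cases hL : L = Set.univ
    · exact ⟨x, hL ▸ trivial, hx⟩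
    · exact Set.not_subset.1 (h1 hL)
  have hL' : ∃ v ∈ L', v ∉ X := by
    by_cases hL' : L' = Set.univ
    · exact ⟨x, hL' ▸ trivial, hx⟩
    · exact Set.not_subset.1 (h1' hL')
  obtain ⟨v, hv, hvX⟩ := hL
  obtain ⟨w, hw, hwX⟩ := hL'
  have hvL' : v ∉ L' := fun h => hvX (h2 ⟨hv, h⟩)
  have hwL : w ∉ L := fun h => hwX (h2 ⟨h, hw⟩)
  have hvw : v ≠ w := by grind
  obtain ⟨u, hvu, hwu, hc⟩ := exists_third hvw
  by_cases hu : u ∈ X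
  · have hXu : X = {u} := view_set_ext hc (by grind)
    by_cases huL : u ∈ L <;> by_cases huL' : u ∈ L'
    · obtain ⟨s, rfl, rfl, rfl⟩ := exists_perm hvu.symm hwu.symm hvw
      exact .inl (.inr ⟨s, hXu, view_set_ext hc (by grind), view_set_ext hc (by grind)⟩)
    · have hL' : L' = {w} := view_set_ext hc (by grind)
      have hL : L = {u, v} := view_set_ext hc (by grind)
      obtain ⟨s, rfl, rfl, rfl⟩ := exists_perm hwu.symm hvu.symm hvw.symm
      exact .inr (.inr (.inr ⟨⟨_, hL'⟩, hL ▸ not_dangling hvu.symm, s, hXu, hL', hL⟩))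
    · have hL : L = {v} := view_set_ext hc (by grind)
      have hL' : L' = {u, w} := view_set_ext hc (by grind)
      obtain ⟨s, rfl, rfl, rfl⟩ := exists_perm hvu.symm hwu.symm hvw
      exact .inr (.inr (.inl ⟨⟨_, hL⟩, hL' ▸ not_dangling hwu.symm, s, hXu, hL, hL'⟩))
    · have hL : L = {v} := view_set_ext hc (by grind)
      have hL' : L' = {w} := view_set_ext hc (by grind)
      obtain ⟨s, rfl, rfl, rfl⟩ := exists_perm hvu.symm hwu.symm hvw
      exact .inr (.inl ⟨⟨_, hL⟩, ⟨_, hL'⟩, s, hXu, hL, hL'⟩)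
  · have hX0 : X = ∅ := view_set_ext hc (by grind)
    obtain ⟨h4, h5⟩ := h3 hX0
    by_cases huL : u ∈ L
    · exact absurd ⟨w, view_set_ext hc (by grind)⟩ h5
    · exact absurd ⟨v, view_set_ext hc (by grind)⟩ h4

/-! ### Local features of reduced problems -/

namespace PointLineProblem

variable {ι κ : Type} {Q : PointLineProblem ι κ}

theorem IsReduced.not_reducibleTo_left (h : Q.IsReduced) {i : ι} {T : Set κ} :
    ¬ Q.ReducibleTo {i}ᶜ T := fun h' => by
  have : i ∈ ({i}ᶜ : Set ι) := (h _ _ h').1 ▸ trivial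
  exact this rfl

theorem IsReduced.not_reducibleTo_right (h : Q.IsReduced) {S : Set ι} {j : κ} :
    ¬ Q.ReducibleTo S {j}ᶜ := fun h' => by
  have : j ∈ ({j}ᶜ : Set κ) := (h _ _ h').2 ▸ trivial
  exact this rfl

theorem inter_viewsLn_subset {i : ι} {j j' : κ} (hj : j ∈ Q.pins i) (hj' : j' ∈ Q.pins i)
    (hjj' : j ≠ j') : Q.viewsLn j ∩ Q.viewsLn j' ⊆ Q.viewsPt i :=
  fun v hv => Q.obs_meet v i j j' hjj' hj hj' hv.1 hv.2

variable [Finite ι] [Finite κ]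

theorem IsReduced.not_viewsLn_subset (h : Q.IsReduced) (hPL1P : Q.IsPL1P) {i : ι} {j : κ}
    (hij : (i, j) ∈ Q.inc) (hV : Q.viewsLn j ≠ Set.univ) : ¬ Q.viewsLn j ⊆ Q.viewsPt i :=
  fun hsub => h.not_reducibleTo_right (reducibleTo_of_pin hPL1P hij hV hsub)

theorem IsReduced.viewsLn_freeLine (h : Q.IsReduced) (hPL1P : Q.IsPL1P) {j : κ}
    (hj : Q.IsFreeLine j) : Q.viewsLn j = Set.univ :=
  by_contra fun hV => h.not_reducibleTo_right (reducibleTo_of_freeLine hPL1P hj hV)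

theorem IsReduced.zeroPinsTable (h : Q.IsReduced) (hPL1P : Q.IsPL1P) {i : ι}
    (hi : Q.pins i = ∅) : ZeroPinsTable (Q.viewsPt i) :=
  zeroPinsTable_of fun hX => h.not_reducibleTo_left (reducibleTo_of_noPins hPL1P hi hX)

theorem IsReduced.onePinTable (h : Q.IsReduced) (hPL1P : Q.IsPL1P) {i : ι} {j : κ}
    (hi : Q.pins i = {j}) :
    OnePinTable (Q.viewsPt i) (Q.viewsLn j) ∨ OnePinDangling (Q.viewsPt i) (Q.viewsLn j) := by
  have hij : j ∈ Q.pins i := by simp [hi]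
  exact onePinTable_of (h.not_viewsLn_subset hPL1P hij)
    (fun hX hsub => h.not_reducibleTo_left (reducibleTo_of_onePin hPL1P hi hX hsub))
    fun u v huv hX hL => h.not_reducibleTo_left
      (reducibleTo_of_onePin_of_separate_views hPL1P hi huv hX hL)

theorem IsReduced.twoPinsTable (h : Q.IsReduced) (hPL1P : Q.IsPL1P) {i : ι} {j j' : κ}
    (hjj' : j ≠ j') (hi : Q.pins i = {j, j'}) :
    TwoPinsTable (Q.viewsPt i) (Q.viewsLn j) (Q.viewsLn j') ∨
      TwoPinsBothDangling (Q.viewsPt i) (Q.viewsLn j) (Q.viewsLn j') ∨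
      TwoPinsOneDangling (Q.viewsPt i) (Q.viewsLn j) (Q.viewsLn j') ∨
      TwoPinsOneDangling (Q.viewsPt i) (Q.viewsLn j') (Q.viewsLn j) := by
  have hj : j ∈ Q.pins i := by simp [hi]
  have hj' : j' ∈ Q.pins i := by simp [hi]
  refine twoPinsTable_of (h.not_viewsLn_subset hPL1P hj) (h.not_viewsLn_subset hPL1P hj')
    (inter_viewsLn_subset hj hj' hjj') fun hX => ⟨?_, ?_⟩
  · rintro ⟨v, hv⟩
    exact h.not_reducibleTo_left (reducibleTo_of_twoPins_of_unseen hPL1P hjj'.symm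
      (hi.trans (Set.pair_comm _ _)) hX hv)
  · rintro ⟨v, hv⟩
    exact h.not_reducibleTo_left (reducibleTo_of_twoPins_of_unseen hPL1P hjj' hi hX hv)

/-- A point with three or more pins and all its pins are seen by all views. -/
theorem IsReduced.views_of_three_le (h : Q.IsReduced) (hPL1P : Q.IsPL1P) {i : ι}
    (hi : 3 ≤ (Q.pins i).ncard) :
    Q.viewsPt i = Set.univ ∧ ∀ j ∈ Q.pins i, Q.viewsLn j = Set.univ := by
  have hX : Q.viewsPt i = Set.univ := by
    by_contra hX
    obtain ⟨x, hx⟩ := (Set.ne_univ_iff_exists_notMem _).1 hX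
    -- Each pin is seen in a view that misses the point, and no other pin is seen there. Three or
    -- more pins thus use up all views: the point is unseen and every pin is dangling.
    have hL (j : Q.pins i) : ∃ v ∈ Q.viewsLn j, v ∉ Q.viewsPt i := by
      by_cases hL : Q.viewsLn j.1 = Set.univ
      · exact ⟨x, hL ▸ trivial, hx⟩
      · exact Set.not_subset.1 (h.not_viewsLn_subset hPL1P j.2 hL)
    choose v hv hvX using hL
    have hdisj (j j' : Q.pins i) (hjj' : v j ∈ Q.viewsLn j') : j' = j := by
      by_contra hne
      exact hvX j (inter_viewsLn_subset j'.2 j.2 (fun h => hne (Subtype.ext h)) ⟨hjj', hv j⟩)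
    have hinj : Function.Injective v := fun j j' hjj' => (hdisj j j' (hjj' ▸ hv j')).symm
    cases nonempty_fintype κ
    have hsurj : Function.Surjective v := by
      classical
      have hcard := Nat.card_coe_set_eq (Q.pins i)
      have : Fintype.card (Q.pins i) = Fintype.card View := by
        apply le_antisymm (Fintype.card_le_of_injective v hinj)
        rw [← Nat.card_eq_fintype_card (α := Q.pins i), hcard]
        simpa using hi
      exact ((Fintype.bijective_iff_injective_and_card v).2 ⟨hinj, this⟩).2
    refine h.not_reducibleTo_left (reducibleTo_of_dangling_of_unseen hPL1P (i := i) ?_ ?_)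
    · refine Set.eq_empty_of_forall_notMem fun w hw => ?_
      obtain ⟨j, rfl⟩ := hsurj w
      exact hvX j hw
    · refine fun j hj => ⟨v ⟨j, hj⟩, Set.eq_singleton_iff_unique_mem.2 ⟨hv ⟨j, hj⟩, fun w hw => ?_⟩⟩
      obtain ⟨j', rfl⟩ := hsurj w
      rw [hdisj j' ⟨j, hj⟩ hw]
  refine ⟨hX, fun j hj => by_contra fun hL => h.not_viewsLn_subset hPL1P hj hL ?_⟩
  rw [hX]
  exact Set.subset_univ _

end PointLineProblem

/-! ### Algebraically independent points -/

/-- A nonzero polynomial does not vanish at a point with independent coordinates over a field that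
contains its coefficients. -/
theorem exists_algebraicIndependent_eval_ne_zero {τ : Type} [Countable τ] {f : MvPolynomial τ ℂ}
    (hf : f ≠ 0) : ∃ (k : IntermediateField ℚ ℂ) (θ : τ → ℂ),
      AlgebraicIndependent k θ ∧ MvPolynomial.eval θ f ≠ 0 := by
  let k := IntermediateField.adjoin ℚ (f.coeffs : Set ℂ)
  have hk : Cardinal.mk k ≤ Cardinal.aleph0 := by
    refine (IntermediateField.cardinalMk_adjoin_le ℚ _).trans ?_
    simp
  obtain ⟨s, hs⟩ := exists_isTranscendenceBasis k ℂ
  -- `k` is countable, so a transcendence basis of `ℂ` over it has the cardinality of the continuum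
  -- and can be indexed injectively by the variables.
  have hcard := IsAlgClosed.cardinal_eq_cardinal_transcendence_basis_of_aleph0_lt' _ hs hk
    (by rw [Cardinal.mk_complex]; exact Cardinal.aleph0_lt_continuum)
  have : Cardinal.mk τ ≤ Cardinal.mk s := by
    rw [← hcard, Cardinal.mk_complex]
    exact (Cardinal.mk_le_aleph0).trans Cardinal.aleph0_lt_continuum.le
  obtain ⟨e⟩ := Cardinal.le_def _ _ |>.1 this
  have hind : AlgebraicIndependent k fun t => ((e t : s) : ℂ) := hs.1.comp e e.injective
  refine ⟨k, _, hind, ?_⟩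
  have hmem : f ∈ Set.range (MvPolynomial.map (σ := τ) (algebraMap k ℂ)) := by
    rw [MvPolynomial.mem_range_map_iff_coeffs_subset]
    intro a ha
    exact ⟨⟨a, IntermediateField.subset_adjoin ℚ _ ha⟩, rfl⟩
  obtain ⟨g, hg⟩ := hmem
  have heval := congrArg (MvPolynomial.eval fun t => ((e t : s) : ℂ)) hg
  rw [MvPolynomial.eval_map, ← MvPolynomial.aeval_def] at heval
  intro h
  exact hf (by rw [← hg, (algebraicIndependent_iff.1 hind) g (heval.trans h), map_zero])

/-- Independent elements of a finitely generated field are at most as many as its generators. -/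
theorem card_le_of_mem_adjoin {k K : Type} [Field k] [Field K] [Algebra k K] {I J : Type}
    [Fintype I] [Fintype J] {x : I → K} (hx : AlgebraicIndependent k x) {b : J → K}
    (h : ∀ i, x i ∈ IntermediateField.adjoin k (Set.range b)) :
    Fintype.card I ≤ Fintype.card J := by
  -- In the matroid of algebraic independence the field generated by `b` lies in the closure of `b`,
  -- whose rank is at most the number of generators.
  have hclosure : Set.range x ⊆ (AlgebraicIndependent.matroid k K).closure (Set.range b) := by
    rintro _ ⟨i, rfl⟩
    rw [AlgebraicIndependent.matroid_closure_eq, SetLike.mem_coe, Subalgebra.mem_algebraicClosure]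
    refine IntermediateField.adjoin_induction k
      (p := fun z _ => IsAlgebraic (Algebra.adjoin k (Set.range b)) z) ?_ ?_ ?_ ?_ ?_ (h i)
    · exact fun z hz => isAlgebraic_algebraMap
        (⟨z, Algebra.subset_adjoin hz⟩ : Algebra.adjoin k (Set.range b))
    · exact fun z => isAlgebraic_algebraMap
        (algebraMap k (Algebra.adjoin k (Set.range b)) z)
    · exact fun _ _ _ _ => IsAlgebraic.add
    · exact fun _ _ => IsAlgebraic.inv
    · exact fun _ _ _ _ => IsAlgebraic.mul
  have hind : (AlgebraicIndependent.matroid k K).Indep (Set.range x) :=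
    AlgebraicIndependent.matroid_indep_iff.2 hx.coe_range
  have h1 := hind.encard_le_eRk_of_subset hclosure
  rw [Matroid.eRk_closure_eq] at h1
  have h2 := h1.trans (Matroid.eRk_le_encard _ _)
  have h3 : (Set.range x).encard = Fintype.card I := by
    rw [← Set.image_univ, Set.InjOn.encard_image hx.injective.injOn, Set.encard_univ,
      ENat.card_eq_coe_fintype_card]
  have h4 : (Set.range b).encard ≤ Fintype.card J := by
    rw [← Set.image_univ, ← ENat.card_eq_coe_fintype_card, ← Set.encard_univ]
    exact Set.encard_image_le _ _
  rw [h3] at h2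
  exact_mod_cast h2.trans h4

theorem minor_ne_zero_of_algebraicIndependent {k K τ : Type} [Field k] [Field K] [Algebra k K]
    {θ : τ → K} (hθ : AlgebraicIndependent k θ) {a b c d : τ} (hab : a ≠ b) (hdb : d ≠ b) :
    θ a * θ d - θ b * θ c ≠ 0 := by
  classical
  intro h
  have h0 := (algebraicIndependent_iff.1 hθ)
    (MvPolynomial.X a * MvPolynomial.X d - MvPolynomial.X b * MvPolynomial.X c) (by simpa using h)
  -- Putting 0 for the variable `b` and 1 for the others gives 1, even if `a`, `c`, `d` are not all
  -- distinct.
  have h1 := congrArg (MvPolynomial.eval fun t => if t = b then (0 : k) else 1) h0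
  simp [hab, hdb] at h1

/-! ### Rotations depend on three parameters -/

theorem inv_mem_of_mem {n : ℕ} {K : Subfield ℂ} {N N' : Matrix (Fin n) (Fin n) ℂ}
    (hN : ∀ a b, N a b ∈ K) (h : N * N' = 1) (a b : Fin n) : N' a b ∈ K := by
  let M : Matrix (Fin n) (Fin n) K := Matrix.of fun a b => ⟨N a b, hN a b⟩
  have hM : K.subtype.mapMatrix M = N := by
    ext a b
    rfl
  have hdet : IsUnit M.det := by
    rw [isUnit_iff_ne_zero]
    intro h0
    have h1 := congrArg K.subtype h0
    rw [RingHom.map_det, hM, map_zero] at h1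
    have h2 := congrArg Matrix.det h
    rw [det_mul, h1, zero_mul, det_one] at h2
    exact zero_ne_one h2
  have h1 := congrArg K.subtype.mapMatrix (Matrix.nonsing_inv_mul M hdet)
  rw [map_mul, hM, map_one] at h1
  have h2 : N' = K.subtype.mapMatrix M⁻¹ := by
    calc N' = K.subtype.mapMatrix M⁻¹ * N * N' := by rw [h1, one_mul]
      _ = _ := by rw [Matrix.mul_assoc, h, Matrix.mul_one]
  rw [h2]
  exact (M⁻¹ a b).2

/-- Cayley's transform needs an invertible 1 + R, which fails for half-turns; a change of column
signs repairs this. Over the four sign matrices of determinant 1 the linear and quadratic terms of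
the determinants cancel, so their sum is 4 + 4 det R = 8. -/
theorem exists_sign_det_ne_zero (R : Matrix (Fin 3) (Fin 3) ℂ) (h : R.det = 1) :
    ∃ d : Fin 3 → ℂ, (∀ a, d a = 1 ∨ d a = -1) ∧ (1 + R * diagonal d).det ≠ 0 := by
  by_contra! hc
  have h1 := hc ![1, 1, 1] (by intro a; fin_cases a <;> simp)
  have h2 := hc ![1, -1, -1] (by intro a; fin_cases a <;> simp)
  have h3 := hc ![-1, 1, -1] (by intro a; fin_cases a <;> simp)
  have h4 := hc ![-1, -1, 1] (by intro a; fin_cases a <;> simp)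
  rw [det_fin_three] at h h1 h2 h3 h4
  simp [Matrix.mul_diagonal] at h1 h2 h3 h4
  have : (8 : ℂ) = 0 := by linear_combination h1 + h2 + h3 + h4 - 4 * h
  norm_num at this

/-- Cayley's parametrization of the rotations: the entries of a rotation are rational functions of
three numbers. -/
theorem exists_rotation_parameters {R : Matrix (Fin 3) (Fin 3) ℂ} (hR : R * Rᵀ = 1)
    (hdet : R.det = 1) : ∃ r : Fin 3 → ℂ, ∀ K : Subfield ℂ, (∀ a, r a ∈ K) → ∀ a b, R a b ∈ K := by
  obtain ⟨d, hd, hU⟩ := exists_sign_det_ne_zero R hdet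
  have hdd : diagonal d * diagonal d = 1 := by
    rw [diagonal_mul_diagonal, ← diagonal_one]
    congr 1
    ext a
    rcases hd a with h | h <;> simp [h]
  set U := R * diagonal d with hUdef
  have hUU : U * Uᵀ = 1 := by
    rw [hUdef, transpose_mul, diagonal_transpose, Matrix.mul_assoc, ← Matrix.mul_assoc (diagonal d),
      hdd, Matrix.one_mul, hR]
  have hUU' : Uᵀ * U = 1 := mul_eq_one_comm.1 hUU
  set B := 1 + U
  set C := B⁻¹
  have hBC : B * C = 1 := Matrix.mul_nonsing_inv B (isUnit_iff_ne_zero.2 hU)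
  have hCB : C * B = 1 := mul_eq_one_comm.1 hBC
  -- The Cayley transform of `U`. It is skew, so its three entries above the diagonal are the
  -- parameters, and `(1 + A) * (1 + U) = 2` recovers `U` rationally.
  set A := (1 - U) * C
  have hskew : Aᵀ = -A := by
    have h1 : Cᵀ * (1 + Uᵀ) = 1 := by
      rw [← transpose_one, ← transpose_add, ← transpose_mul, hBC]
    have h2 : (1 - Uᵀ) * B = -((1 + Uᵀ) * (1 - U)) := by
      simp only [B, sub_mul, mul_add, add_mul, mul_sub, hUU', Matrix.one_mul, Matrix.mul_one]
      abel
    calc Aᵀ = Cᵀ * (1 - Uᵀ) * (B * C) := by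
          rw [hBC, Matrix.mul_one]
          simp [A, transpose_mul]
      _ = Cᵀ * ((1 - Uᵀ) * B) * C := by simp only [Matrix.mul_assoc]
      _ = -(Cᵀ * (1 + Uᵀ) * ((1 - U) * C)) := by
          rw [h2]
          simp only [Matrix.mul_neg, Matrix.neg_mul, Matrix.mul_assoc]
      _ = -A := by rw [h1, Matrix.one_mul]
  have hAB : (1 + A) * B = 2 := by
    rw [add_mul, Matrix.one_mul, Matrix.mul_assoc, hCB, Matrix.mul_one]
    simp only [B]
    rw [← one_add_one_eq_two]
    abel
  have hsk (a b : Fin 3) : A a b = -A b a := by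
    have := congrFun (congrFun hskew b) a
    simpa using this
  refine ⟨![A 0 1, A 0 2, A 1 2], fun K hK => ?_⟩
  have h01 : A 0 1 ∈ K := hK 0
  have h02 : A 0 2 ∈ K := hK 1
  have h12 : A 1 2 ∈ K := hK 2
  have hdiag (a : Fin 3) : A a a = 0 := by
    have := hsk a a
    linear_combination this / 2
  have hA (a b : Fin 3) : A a b ∈ K := by
    fin_cases a <;> fin_cases b
    · exact (hdiag 0).symm ▸ K.zero_mem
    · exact h01
    · exact h02
    · exact (hsk 1 0).symm ▸ K.neg_mem h01
    · exact (hdiag 1).symm ▸ K.zero_mem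
    · exact h12
    · exact (hsk 2 0).symm ▸ K.neg_mem h02
    · exact (hsk 2 1).symm ▸ K.neg_mem h12
    · exact (hdiag 2).symm ▸ K.zero_mem
  have hone (a b : Fin 3) : (1 : Matrix (Fin 3) (Fin 3) ℂ) a b ∈ K := by
    rw [Matrix.one_apply]
    split_ifs
    exacts [K.one_mem, K.zero_mem]
  have h2K : (2 : ℂ) ∈ K := by
    rw [← one_add_one_eq_two]
    exact K.add_mem K.one_mem K.one_mem
  have hinv : (1 + A) * ((2 : ℂ)⁻¹ • B) = 1 := by
    have h2 : (2 : Matrix (Fin 3) (Fin 3) ℂ) = (2 : ℂ) • 1 := by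
      rw [← one_add_one_eq_two, ← one_add_one_eq_two, add_smul, one_smul]
    rw [Matrix.mul_smul, hAB, h2, smul_smul, inv_mul_cancel₀ two_ne_zero, one_smul]
  have hB (a b : Fin 3) : B a b ∈ K := by
    have h1 := inv_mem_of_mem (fun a b => K.add_mem (hone a b) (hA a b)) hinv a b
    have h2 := K.mul_mem h2K h1
    simpa using h2
  intro a b
  have hUab : U a b ∈ K := by
    have : U a b = B a b - (1 : Matrix (Fin 3) (Fin 3) ℂ) a b := by simp [B]
    rw [this]
    exact K.sub_mem (hB a b) (hone a b)
  have hRab : R a b = U a b * d b := by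
    rw [hUdef, Matrix.mul_diagonal]
    rcases hd b with h | h <;> simp [h]
  rw [hRab]
  refine K.mul_mem hUab ?_
  rcases hd b with h | h <;> rw [h]
  exacts [K.one_mem, K.neg_mem K.one_mem]

theorem range_fin_two {α : Type*} (F : Fin 2 → α) : Set.range F = {F 0, F 1} := by
  ext x
  simp [eq_comm]

/-! ### Parametrized joint images -/

/-- Parameters of joint images: three coordinates for each image point, two spanning points for each
image line (the first one is not used if an observed point is on the line), and a change of frame
for each image line. -/
abbrev ImageParam (ι κ : Type) : Type :=
  (View × ι × Fin 3) ⊕ (View × κ × Fin 3) ⊕ (View × κ × Fin 3) ⊕ (View × κ × Fin 2 × Fin 2)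

namespace PointLineProblem

variable {ι κ : Type} (Q : PointLineProblem ι κ)

/-- The image points given by parameters. -/
def paramPt (θ : ImageParam ι κ → ℂ) (v : View) (i : ι) : Fin 3 → ℂ := fun a => θ (.inl (v, i, a))

/-- The second spanning points of the image lines given by parameters. -/
def paramDir (θ : ImageParam ι κ → ℂ) (v : View) (j : κ) : Fin 3 → ℂ :=
  fun a => θ (.inr (.inl (v, j, a)))

open Classical in
/-- The parameters of the first spanning point of an image line: an image point if there is an
observed point on the line. -/
noncomputable def baseIndex (v : View) (j : κ) (a : Fin 3) : ImageParam ι κ :=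
  if h : ∃ i, (i, j) ∈ Q.inc ∧ i ∈ Q.obsPt v then .inl (v, h.choose, a)
  else .inr (.inr (.inl (v, j, a)))

/-- The first spanning points of the image lines given by parameters. -/
noncomputable def paramBase (θ : ImageParam ι κ → ℂ) (v : View) (j : κ) : Fin 3 → ℂ :=
  fun a => θ (Q.baseIndex v j a)

/-- The homogeneous coordinates of a joint image given by parameters. -/
noncomputable def paramCoord (θ : ImageParam ι κ → ℂ) :
    (Σ v : View, Q.obsPt v × Fin 1 × Fin 3) ⊕ (Σ v : View, Q.obsLn v × Fin 2 × Fin 3) → ℂ :=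
  Sum.elim (fun s => paramPt θ s.1 s.2.1 s.2.2.2) fun s =>
    θ (.inr (.inr (.inr (s.1, s.2.1, s.2.2.1, 0)))) * Q.paramBase θ s.1 s.2.1 s.2.2.2 +
    θ (.inr (.inr (.inr (s.1, s.2.1, s.2.2.1, 1)))) * paramDir θ s.1 s.2.1 s.2.2.2

variable {Q}

theorem paramBase_eq (hPL1P : Q.IsPL1P) (θ : ImageParam ι κ → ℂ) {v : View} {i : ι} {j : κ}
    (hij : (i, j) ∈ Q.inc) (hi : i ∈ Q.obsPt v) : Q.paramBase θ v j = paramPt θ v i := by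
  have h : ∃ i, (i, j) ∈ Q.inc ∧ i ∈ Q.obsPt v := ⟨i, hij, hi⟩
  have hi' : h.choose = i := hPL1P j h.choose_spec.1 hij
  ext a
  rw [paramBase, baseIndex, dif_pos h, hi']
  rfl

theorem isPolynomial_paramCoord (s) : IsPolynomial fun θ => Q.paramCoord θ s := by
  rcases s with s | s
  · exact .coord _
  · exact .add (.mul (.coord _) (.coord _)) (.mul (.coord _) (.coord _))

/-- Every system of homogeneous coordinates of a joint image is given by parameters. -/
theorem exists_paramCoord_eq {y : JointImage Q} (hy : y ∈ Q.images) {c} (hc : imageCoord y c) :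
    ∃ θ, Q.paramCoord θ = c := by
  classical
  let x (v : View) (i : ι) : Fin 3 → ℂ :=
    if h : i ∈ Q.obsPt v then fun a => c (.inl ⟨v, ⟨i, h⟩, 0, a⟩) else 0
  have hln (v : View) (j : κ) : ∃ (q u : Fin 3 → ℂ) (M : Fin 2 → Fin 2 → ℂ),
      (∀ h : ∃ i, (i, j) ∈ Q.inc ∧ i ∈ Q.obsPt v, q = x v h.choose) ∧
      ∀ (h : j ∈ Q.obsLn v) a b, c (.inr ⟨v, ⟨j, h⟩, a, b⟩) = M a 0 * q b + M a 1 * u b := by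
    by_cases hj : j ∈ Q.obsLn v
    · by_cases h : ∃ i, (i, j) ∈ Q.inc ∧ i ∈ Q.obsPt v
      · have hspec := h.choose_spec
        set i := h.choose
        have hxi : x v i = fun a => c (.inl ⟨v, ⟨i, hspec.2⟩, 0, a⟩) := dif_pos hspec.2
        have hx := (hc.1 v ⟨i, hspec.2⟩).eq_span_singleton
        have hx0 := (hc.1 v ⟨i, hspec.2⟩).linearIndependent.ne_zero 0
        rw [← hxi] at hx hx0
        have hmem : x v i ∈ (y.ln v ⟨j, hj⟩).1 := hy v ⟨i, hspec.2⟩ ⟨j, hj⟩ hspec.1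
          (by rw [hx]; exact Submodule.mem_span_singleton_self _)
        obtain ⟨u, -, -, hu⟩ := exists_span_pair_eq (y.ln v ⟨j, hj⟩).2 hmem hx0
        have hF (a : Fin 2) : (fun b => c (.inr ⟨v, ⟨j, hj⟩, a, b⟩)) ∈
            Submodule.span ℂ {x v i, u} := by
          rw [hu, ← hc.2 v ⟨j, hj⟩]
          exact Submodule.subset_span ⟨a, rfl⟩
        simp only [Submodule.mem_span_pair] at hF
        choose α β hαβ using hF
        refine ⟨x v i, u, fun a => ![α a, β a], fun _ => rfl, fun _ a b => ?_⟩
        have := congrFun (hαβ a) b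
        simpa using this.symm
      -- Without an observed point on the line its two frame vectors are free parameters, and the
      -- change of frame is the identity.
      · refine ⟨fun b => c (.inr ⟨v, ⟨j, hj⟩, 0, b⟩), fun b => c (.inr ⟨v, ⟨j, hj⟩, 1, b⟩),
          fun a => ![if a = 0 then 1 else 0, if a = 0 then 0 else 1], fun h' => absurd h' h,
          fun _ a b => ?_⟩
        fin_cases a <;> simp
    · by_cases h : ∃ i, (i, j) ∈ Q.inc ∧ i ∈ Q.obsPt v
      · exact ⟨x v h.choose, 0, 0, fun _ => rfl, fun h => absurd h hj⟩
      · exact ⟨0, 0, 0, fun h' => absurd h' h, fun h => absurd h hj⟩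
  choose q u M hq hM using hln
  let θ : ImageParam ι κ → ℂ := Sum.elim (fun s => x s.1 s.2.1 s.2.2) (Sum.elim
    (fun s => u s.1 s.2.1 s.2.2) (Sum.elim (fun s => q s.1 s.2.1 s.2.2)
      fun s => M s.1 s.2.1 s.2.2.1 s.2.2.2))
  have hbase (v j) : Q.paramBase θ v j = q v j := by
    ext a
    by_cases h : ∃ i, (i, j) ∈ Q.inc ∧ i ∈ Q.obsPt v
    · rw [paramBase, baseIndex, dif_pos h, hq v j h]
      rfl
    · rw [paramBase, baseIndex, dif_neg h]
      rfl
  refine ⟨θ, funext fun s => ?_⟩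
  rcases s with ⟨v, i, a, b⟩ | ⟨v, j, a, b⟩
  · obtain rfl : a = 0 := Subsingleton.elim _ _
    change x v i b = _
    simp only [x, dif_pos i.2]
  · change M v j a 0 * Q.paramBase θ v j b + M v j a 1 * u v j b = _
    rw [hbase, hM v j j.2]

/-- Independent parameters give a joint image. -/
theorem exists_imageCoord_paramCoord (hPL1P : Q.IsPL1P) {k : IntermediateField ℚ ℂ}
    {θ : ImageParam ι κ → ℂ} (hθ : AlgebraicIndependent k θ) :
    ∃ y ∈ Q.images, imageCoord y (Q.paramCoord θ) ∧
      (∀ v i, (y.pt v i).1 = Submodule.span ℂ {paramPt θ v i}) ∧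
      ∀ v j, (y.ln v j).1 = Submodule.span ℂ {Q.paramBase θ v j, paramDir θ v j} := by
  have hpt (v i) : paramPt θ v i ≠ 0 := fun h =>
    hθ.ne_zero (.inl (v, i, 0)) (congrFun h 0)
  have hbase (v j a) : Q.baseIndex v j a ≠ Q.baseIndex v j (a + 1) ∧
      ∀ b, (.inr (.inl (v, j, b))) ≠ Q.baseIndex v j a := by
    by_cases h : ∃ i, (i, j) ∈ Q.inc ∧ i ∈ Q.obsPt v
    · simp [baseIndex, dif_pos h]
    · simp [baseIndex, dif_neg h]
  have hln (v j) := pair_independent_of_minor (x := Q.paramBase θ v j) (y := paramDir θ v j)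
    (minor_ne_zero_of_algebraicIndependent hθ (hbase v j 0).1 ((hbase v j _).2 _))
  refine ⟨⟨fun v i => ⟨_, finrank_span_singleton (hpt v i)⟩,
    fun v j => ⟨_, finrank_span_pair (hln v j)⟩⟩, fun v i j hij => ?_, ⟨fun v i => ?_,
      fun v j => ?_⟩, fun v i => rfl, fun v j => rfl⟩
  · change Submodule.span ℂ {paramPt θ v i} ≤
      Submodule.span ℂ {Q.paramBase θ v j, paramDir θ v j}
    rw [paramBase_eq hPL1P θ hij i.2]
    exact Submodule.span_mono (by simp)
  · change Submodule.span ℂ (Set.range fun _ : Fin 1 => paramPt θ v i) =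
      Submodule.span ℂ {paramPt θ v i}
    rw [Set.range_const]
  · let m (a b : Fin 2) : ℂ := θ (.inr (.inr (.inr (v, j, a, b))))
    have hm : m 0 0 * m 1 1 - m 0 1 * m 1 0 ≠ 0 :=
      minor_ne_zero_of_algebraicIndependent hθ (by simp) (by simp)
    let F (a : Fin 2) : Fin 3 → ℂ := m a 0 • Q.paramBase θ v j + m a 1 • paramDir θ v j
    change Submodule.span ℂ (Set.range F) =
      Submodule.span ℂ {Q.paramBase θ v j, paramDir θ v j}
    have hmem (a) : F a ∈ Submodule.span ℂ {Q.paramBase θ v j.1, paramDir θ v j.1} :=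
      Submodule.mem_span_pair.2 ⟨_, _, rfl⟩
    rw [range_fin_two]
    refine span_pair_eq_of_mem (finrank_span_pair (hln v j)) (hmem 0) (hmem 1)
      fun a b hab => ?_
    obtain ⟨h0, h1⟩ := hln v j (a * m 0 0 + b * m 1 0) (a * m 0 1 + b * m 1 1) (by
      rw [← hab]
      simp only [F]
      module)
    refine pair_independent_of_minor (x := m 0) (y := m 1) hm a b (by
      ext c
      fin_cases c <;> simpa)

/-- If the joint camera map is dominant, then a joint image with independent parameters has a
solution. -/
theorem IsDominant.exists_solution [Countable ι] [Countable κ] (hPL1P : Q.IsPL1P)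
    (h : Q.IsDominant) :
    ∃ (k : IntermediateField ℚ ℂ) (θ : ImageParam ι κ → ℂ), AlgebraicIndependent k θ ∧
      ∃ y : JointImage Q, (Q.solutions y).Nonempty ∧
        (∀ v i, (y.pt v i).1 = Submodule.span ℂ {paramPt θ v i}) ∧
        ∀ v j, (y.ln v j).1 = Submodule.span ℂ {Q.paramBase θ v j, paramDir θ v j} := by
  obtain ⟨f, ⟨y₀, hy₀, c₀, hc₀, hf⟩, hsol⟩ := h
  choose g hg using isPolynomial_paramCoord (Q := Q)
  have heval (θ : ImageParam ι κ → ℂ) : MvPolynomial.eval θ (MvPolynomial.bind₁ g f) =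
      MvPolynomial.eval (Q.paramCoord θ) f := by
    rw [← MvPolynomial.coe_aeval_eq_eval, ← MvPolynomial.coe_aeval_eq_eval, RingHom.coe_coe,
      RingHom.coe_coe, MvPolynomial.aeval_bind₁]
    congr 2
    ext s
    exact hg s θ
  obtain ⟨θ₀, hθ₀⟩ := exists_paramCoord_eq hy₀ hc₀
  -- The parameters range over an affine space, so pulling back `f` gives a polynomial in free
  -- variables. It is nonzero since `c₀` is attained, and independent parameters avoid its zeros.
  have hne : MvPolynomial.bind₁ g f ≠ 0 := by
    intro h0
    have := heval θ₀
    rw [h0, map_zero, hθ₀] at this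
    exact hf this.symm
  obtain ⟨k, θ, hθ, hθf⟩ := exists_algebraicIndependent_eval_ne_zero hne
  obtain ⟨y, hy, hc, hpt, hln⟩ := exists_imageCoord_paramCoord hPL1P hθ
  exact ⟨k, θ, hθ, y, hsol y hy _ hc (by rwa [← heval]), hpt, hln⟩

/-! ### Solutions -/

/-- A point `(x, w)` seen by the first camera at `x`, and lines `(u, s)` through it seen in the
direction `u`. -/
theorem exists_depth (hPL1P : Q.IsPL1P) {θ : ImageParam ι κ → ℂ} {y : JointImage Q}
    (hpt : ∀ v i, (y.pt v i).1 = Submodule.span ℂ {paramPt θ v i.1})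
    (hln : ∀ v j, (y.ln v j).1 = Submodule.span ℂ {Q.paramBase θ v j.1, paramDir θ v j.1})
    {A : Arrangement ι κ} {P : Cameras} (hsol : (A, P) ∈ Q.solutions y) {i : ι}
    (hi : Q.viewsPt i = Set.univ) (hpins : ∀ j ∈ Q.pins i, Q.viewsLn j = Set.univ) :
    ∃ w : ℂ, (∀ v, Submodule.span ℂ {rot (P v) *ᵥ paramPt θ 0 i + w • transl (P v)} =
        Submodule.span ℂ {paramPt θ v i}) ∧
      ∀ j ∈ Q.pins i, ∃ s : ℂ, ∀ v, Submodule.span ℂ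
        {rot (P v) *ᵥ paramPt θ 0 i + w • transl (P v),
          rot (P v) *ᵥ paramDir θ 0 j + s • transl (P v)} =
        Submodule.span ℂ {paramPt θ v i, paramDir θ v j} := by
  obtain ⟨⟨hA, hP⟩, hproj⟩ := hsol
  have hiv (v : View) : i ∈ Q.obsPt v := by
    change v ∈ Q.viewsPt i
    rw [hi]
    trivial
  -- The first camera is [I | 0], so a vector is its first image together with a last coordinate.
  -- These last coordinates are the `w` and `s` of the statement.
  have hP0 (z : Fin 4 → ℂ) : z = Fin.snoc (α := fun _ => ℂ) (P 0 *ᵥ z) (z 3) := by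
    rw [mulVec_eq_rot_add_transl, hP.2.1, hP.2.2.1]
    ext a
    refine Fin.lastCases ?_ (fun a => ?_) a
    · rw [Fin.snoc_last]
      rfl
    · simp
  have hX (v : View) : (A.pt i).1.map (toLin' (P v)) = Submodule.span ℂ {paramPt θ v i} := by
    rw [← hpt v ⟨i, hiv v⟩]
    exact hproj.1 v ⟨i, hiv v⟩
  have hx0 : paramPt θ 0 i ≠ 0 := by
    intro h0
    have := (y.pt 0 ⟨i, hiv 0⟩).2
    rw [hpt 0 ⟨i, hiv 0⟩, h0, Submodule.span_zero_singleton, finrank_bot] at this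
    exact zero_ne_one this
  have hmem : paramPt θ 0 i ∈ (A.pt i).1.map (toLin' (P 0)) := by
    rw [hX]
    exact Submodule.mem_span_singleton_self _
  obtain ⟨ξ, hξ, hξx⟩ := hmem
  rw [toLin'_apply] at hξx
  have hξ0 : ξ ≠ 0 := by
    rintro rfl
    rw [mulVec_zero] at hξx
    exact hx0 hξx.symm
  have hξeq := hP0 ξ
  rw [hξx] at hξeq
  have hspan := span_singleton_eq_of_mem (A.pt i).2 hξ hξ0
  refine ⟨ξ 3, fun v => ?_, fun j hj => ?_⟩
  · rw [← hX v, ← hspan, map_span_singleton, ← mulVec_snoc, ← hξeq]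
  have hjv (v : View) : j ∈ Q.obsLn v := by
    change v ∈ Q.viewsLn j
    rw [hpins j hj]
    trivial
  have hL (v : View) : (A.ln j).1.map (toLin' (P v)) =
      Submodule.span ℂ {paramPt θ v i, paramDir θ v j} := by
    rw [← paramBase_eq hPL1P θ hj (hiv v), ← hln v ⟨j, hjv v⟩]
    exact hproj.2 v ⟨j, hjv v⟩
  have hmem : paramDir θ 0 j ∈ (A.ln j).1.map (toLin' (P 0)) := by
    rw [hL]
    exact Submodule.subset_span (by simp)
  obtain ⟨η, hη, hηu⟩ := hmem
  rw [toLin'_apply] at hηu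
  have hηeq := hP0 η
  rw [hηu] at hηeq
  have hfin : Module.finrank ℂ (Submodule.span ℂ {P 0 *ᵥ ξ, P 0 *ᵥ η}) = 2 := by
    rw [hξx, hηu, ← paramBase_eq hPL1P θ hj (hiv 0), ← hln 0 ⟨j, hjv 0⟩,
      (y.ln 0 ⟨j, hjv 0⟩).2]
  have hspan' : Submodule.span ℂ {ξ, η} = (A.ln j).1 := by
    apply Submodule.eq_of_le_of_finrank_eq
    · rw [Submodule.span_le]
      rintro z (rfl | rfl)
      exacts [hA i j hj hξ, hη]
    · rw [finrank_span_pair_of_mulVec hfin, (A.ln j).2]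
  refine ⟨η 3, fun v => ?_⟩
  rw [← hL v, ← hspan', map_span_pair, ← mulVec_snoc, ← mulVec_snoc, ← hξeq, ← hηeq]

end PointLineProblem

theorem nonempty_embedding_of_card_le_ncard {α β : Type} [Fintype α] [Finite β] {s : Set β}
    (h : Fintype.card α ≤ s.ncard) : Nonempty (α ↪ s) := by
  cases nonempty_fintype s
  apply Function.Embedding.nonempty_of_card_le
  rwa [← Nat.card_eq_fintype_card (α := s), Nat.card_coe_set_eq]

/-! ### At most seven pins -/

/-- Coordinates on the pencil of lines through the point `x`: the line through `x` and `u` meets the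
line at infinity at this point. -/
def pencilCoord (x u : Fin 3 → ℂ) (a : Fin 2) : ℂ := x 2 * u a.castSucc - u 2 * x a.castSucc

theorem smul_eq_of_pencilCoord_eq_zero {x z : Fin 3 → ℂ} (hx : x 2 ≠ 0)
    (h : ∀ a, pencilCoord x z a = 0) : z ∈ Submodule.span ℂ {x} := by
  rw [Submodule.mem_span_singleton]
  refine ⟨z 2 / x 2, ?_⟩
  have h0 : x 2 * z 0 - z 2 * x 0 = 0 := h 0
  have h1 : x 2 * z 1 - z 2 * x 1 = 0 := h 1
  ext a
  fin_cases a <;> simp <;> field_simp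
  · linear_combination -h0
  · linear_combination -h1

theorem pencilCoord_add_smul (x z z' : Fin 3 → ℂ) (s : ℂ) (a : Fin 2) :
    pencilCoord x (z + s • z') a = pencilCoord x z a + s * pencilCoord x z' a := by
  simp [pencilCoord]
  ring

/-- The bracket of a point of the pencil with `z`. -/
def bracket (x z : Fin 3 → ℂ) (b : Fin 2) : ℂ := ![pencilCoord x z 1, -pencilCoord x z 0] b

theorem bracket_add_smul (x z z' : Fin 3 → ℂ) (s : ℂ) (b : Fin 2) :
    bracket x (z + s • z') b = bracket x z b + s * bracket x z' b := by
  fin_cases b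
  · exact pencilCoord_add_smul x z z' s 1
  · change -pencilCoord _ _ _ = -pencilCoord _ _ _ + s * -pencilCoord _ _ _
    rw [pencilCoord_add_smul]
    ring

theorem bracket_smul (x z : Fin 3 → ℂ) (s : ℂ) (b : Fin 2) :
    bracket x (s • z) b = s * bracket x z b := by
  fin_cases b <;> simp [bracket, pencilCoord] <;> ring

/-- Up to sign the sum is the 2 × 2 determinant of the pencil coordinates of `z` and `u`, which are
proportional when `z` is on the line through `x` and `u`. -/
theorem sum_bracket_eq_zero {x u z : Fin 3 → ℂ} (hz : z ∈ Submodule.span ℂ {x, u}) :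
    ∑ b, bracket x z b * pencilCoord x u b = 0 := by
  obtain ⟨α, β, rfl⟩ := Submodule.mem_span_pair.1 hz
  simp [bracket, pencilCoord, Fin.sum_univ_two]
  ring

/-- The relation between the directions `m`, `m'` of the images in two views of a line through a
point which is seen at `x₀` and `x`, up to a parameter `σ` of the line. -/
theorem exists_bilinear_relation {P : Matrix (Fin 3) (Fin 4) ℂ} {x₀ x u₀ u : Fin 3 → ℂ} {w s : ℂ}
    (hx : rot P *ᵥ x₀ + w • transl P ∈ Submodule.span ℂ {x})
    (hu : rot P *ᵥ u₀ + s • transl P ∈ Submodule.span ℂ {x, u}) :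
    ∑ a : Fin 2, ∑ b : Fin 2, bracket x (rot P *ᵥ Pi.single a.castSucc 1) b *
        pencilCoord x₀ u₀ a * pencilCoord x u b +
      (x₀ 2 * s - u₀ 2 * w) * ∑ b : Fin 2, bracket x (transl P) b * pencilCoord x u b = 0 := by
  -- The combination `x₀ 2 • u₀ - u₀ 2 • x₀` has third coordinate 0 and the pencil coordinates as
  -- its other two.
  have hz : (∑ a : Fin 2, pencilCoord x₀ u₀ a • (rot P *ᵥ Pi.single a.castSucc 1)) +
      (x₀ 2 * s - u₀ 2 * w) • transl P ∈ Submodule.span ℂ {x, u} := by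
    have h1 := Submodule.sub_mem _ (Submodule.smul_mem _ (x₀ 2) hu)
      (Submodule.smul_mem _ (u₀ 2) (Submodule.span_mono (show ({x} : Set (Fin 3 → ℂ)) ⊆ {x, u} by simp) hx))
    convert h1 using 1
    ext c
    simp [Fin.sum_univ_two, Matrix.mulVec, dotProduct, Fin.sum_univ_three, pencilCoord]
    ring
  have h := sum_bracket_eq_zero hz
  simp only [bracket_add_smul, bracket_smul, Fin.sum_univ_two] at h ⊢
  linear_combination h

/-- Otherwise R would send two basis vectors, and also `x₀`, into the span of `x` and the
translation. Since `x₀ 2 ≠ 0` these three form a basis, so R would not be surjective. -/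
theorem bracket_ne_smul {P : Matrix (Fin 3) (Fin 4) ℂ} (hP : IsCalibrated P) {x₀ x : Fin 3 → ℂ}
    {w : ℂ} (h0 : x₀ 2 ≠ 0) (h1 : x 2 ≠ 0)
    (hx : rot P *ᵥ x₀ + w • transl P ∈ Submodule.span ℂ {x}) (δ : Fin 2 → ℂ) :
    ¬ ∀ a b, bracket x (rot P *ᵥ Pi.single a.castSucc 1) b = δ a * bracket x (transl P) b := by
  intro h
  have hle : Submodule.span ℂ {x} ≤ Submodule.span ℂ {x, transl P} :=
    Submodule.span_mono (by simp)
  have ht : transl P ∈ Submodule.span ℂ {x, transl P} := Submodule.subset_span (by simp)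
  have hmem (a : Fin 2) : rot P *ᵥ Pi.single a.castSucc 1 ∈
      Submodule.span ℂ {x, transl P} := by
    have hb (b : Fin 2) : bracket x
        (rot P *ᵥ Pi.single a.castSucc 1 + (-δ a) • transl P) b = 0 := by
      rw [bracket_add_smul, h]
      ring
    have := smul_eq_of_pencilCoord_eq_zero h1 (z := rot P *ᵥ Pi.single a.castSucc 1 +
      (-δ a) • transl P) fun b => by
        fin_cases b
        · exact neg_eq_zero.1 (hb 1)
        · exact hb 0
    have h2 := Submodule.add_mem _ (hle this) (Submodule.smul_mem _ (δ a) ht)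
    simpa using h2
  have hmem0 : rot P *ᵥ x₀ ∈ Submodule.span ℂ {x, transl P} := by
    have h2 := Submodule.sub_mem _ (hle hx) (Submodule.smul_mem _ w ht)
    simpa using h2
  refine not_le_of_finrank_lt (W := ⊤) (A := Submodule.span ℂ {x, transl P}) ?_ fun p _ => ?_
  · have := finrank_span_pair_le x (transl P)
    simp
    omega
  · have hp : p = rot P *ᵥ ((rot P)ᵀ *ᵥ p) := by
      rw [mulVec_mulVec, hP, one_mulVec]
    set z := (rot P)ᵀ *ᵥ p
    have hz : z = (z 2 / x₀ 2) • x₀ + ((z 0 - z 2 / x₀ 2 * x₀ 0) • Pi.single 0 1 +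
        (z 1 - z 2 / x₀ 2 * x₀ 1) • Pi.single 1 1) := by
      ext c
      fin_cases c <;> simp
      field_simp
    rw [hp, hz, mulVec_add, mulVec_add, mulVec_smul, mulVec_smul, mulVec_smul]
    exact Submodule.add_mem _ (Submodule.smul_mem _ _ hmem0) (Submodule.add_mem _
      (Submodule.smul_mem _ _ (hmem 0)) (Submodule.smul_mem _ _ (hmem 1)))

/-- The directions of the images of the lines through a point satisfy a trilinear relation. -/
theorem exists_trilinear_relation {P : Cameras} (hP : P ∈ cams) {x : View → Fin 3 → ℂ} {w : ℂ}
    (hx0 : ∀ v, x v 2 ≠ 0)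
    (hx : ∀ v, rot (P v) *ᵥ x 0 + w • transl (P v) ∈ Submodule.span ℂ {x v}) :
    ∃ T : Fin 2 × Fin 2 × Fin 2 → ℂ, T ≠ 0 ∧ ∀ (u : View → Fin 3 → ℂ) (s : ℂ),
      (∀ v, rot (P v) *ᵥ u 0 + s • transl (P v) ∈ Submodule.span ℂ {x v, u v}) →
      ∑ c, T c * (pencilCoord (x 0) (u 0) c.1 * pencilCoord (x 1) (u 1) c.2.1 *
        pencilCoord (x 2) (u 2) c.2.2) = 0 := by
  let β (v : View) (a b : Fin 2) : ℂ := bracket (x v) (rot (P v) *ᵥ Pi.single a.castSucc 1) b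
  let γ (v : View) (b : Fin 2) : ℂ := bracket (x v) (transl (P v)) b
  have hβγ (v : View) (δ : Fin 2 → ℂ) : ¬ ∀ a b, β v a b = δ a * γ v b :=
    bracket_ne_smul (isCalibrated_of_mem_cams hP v) (hx0 0) (hx0 v) (hx v) δ
  have hβ (v : View) : ∃ a b, β v a b ≠ 0 := by
    by_contra! h
    exact hβγ v 0 fun a b => by simp [h]
  have hrel (u : View → Fin 3 → ℂ) (s : ℂ)
      (hu : ∀ v, rot (P v) *ᵥ u 0 + s • transl (P v) ∈ Submodule.span ℂ {x v, u v}) (v : View) :=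
    exists_bilinear_relation (hx v) (hu v)
  change ∀ u s, _ → ∀ v, ∑ a, ∑ b, β v a b * _ * _ + _ * ∑ b, γ v b * _ = 0 at hrel
  by_cases h1 : γ 1 = 0
  -- The relation for view 1 is then free of the line parameter; multiplied by a pencil coordinate
  -- of view 2 it becomes trilinear. The case `γ 2 = 0` is symmetric.
  · obtain ⟨a, b, hab⟩ := hβ 1
    refine ⟨fun c => β 1 c.1 c.2.1 * if c.2.2 = 0 then 1 else 0,
      fun h => hab (by simpa using congrFun h (a, b, 0)), fun u s hu => ?_⟩
    have := hrel u s hu 1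
    simp only [h1, Fintype.sum_prod_type, Fin.sum_univ_two, Pi.zero_apply] at this ⊢
    simp
    linear_combination pencilCoord (x 2) (u 2) 0 * this
  by_cases h2 : γ 2 = 0
  · obtain ⟨a, b, hab⟩ := hβ 2
    refine ⟨fun c => β 2 c.1 c.2.2 * if c.2.1 = 0 then 1 else 0,
      fun h => hab (by simpa using congrFun h (a, 0, b)), fun u s hu => ?_⟩
    have := hrel u s hu 2
    simp only [h2, Fintype.sum_prod_type, Fin.sum_univ_two, Pi.zero_apply] at this ⊢
    simp
    linear_combination pencilCoord (x 1) (u 1) 0 * this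
  · obtain ⟨c₀, hc₀⟩ := Function.ne_iff.1 h2
    have hc₀' : γ 2 c₀ ≠ 0 := hc₀
    -- The line parameter is the same in both bilinear relations, and this tensor eliminates it. If
    -- it vanished, `β 1` would be a product with `γ 1`, against `hβγ`.
    refine ⟨fun c => β 1 c.1 c.2.1 * γ 2 c.2.2 - β 2 c.1 c.2.2 * γ 1 c.2.1, fun h => ?_,
      fun u s hu => ?_⟩
    · refine hβγ 1 (fun a => β 2 a c₀ / γ 2 c₀) fun a b => ?_
      have : β 1 a b * γ 2 c₀ - β 2 a c₀ * γ 1 b = 0 := congrFun h (a, b, c₀)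
      field_simp
      linear_combination this
    · have e1 := hrel u s hu 1
      have e2 := hrel u s hu 2
      simp only [Fintype.sum_prod_type, Fin.sum_univ_two] at e1 e2 ⊢
      linear_combination (γ 2 0 * pencilCoord (x 2) (u 2) 0 +
        γ 2 1 * pencilCoord (x 2) (u 2) 1) * e1 - (γ 1 0 * pencilCoord (x 1) (u 1) 0 +
        γ 1 1 * pencilCoord (x 1) (u 1) 1) * e2

/-- Labels of eight lines through a point. -/
abbrev Octet : Type := Fin 2 × Fin 2 × Fin 2

/-- Labels of the coordinates of a point in three views and of eight directions through it. -/
abbrev OctetParam : Type := (View × Fin 3) ⊕ (View × Octet × Fin 3)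

/-- The coordinates of eight lines on the pencils through three image points, as polynomials. -/
noncomputable def pencilPoly (k : Type) [CommRing k] (v : View) (j : Octet) (a : Fin 2) :
    MvPolynomial OctetParam k :=
  MvPolynomial.X (.inl (v, 2)) * MvPolynomial.X (.inr (v, j, a.castSucc)) -
    MvPolynomial.X (.inr (v, j, 2)) * MvPolynomial.X (.inl (v, a.castSucc))

/-- The monomials of the trilinear relations for eight lines. -/
noncomputable def pencilMatrix (k : Type) [CommRing k] : Matrix Octet Octet (MvPolynomial OctetParam k) :=
  Matrix.of fun j c => pencilPoly k 0 j c.1 * pencilPoly k 1 j c.2.1 * pencilPoly k 2 j c.2.2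

/-- Eight lines for which the trilinear monomials are independent. -/
def octetPoint (k : Type) [CommRing k] : OctetParam → k :=
  Sum.elim (fun s => if s.2 = 2 then 1 else 0)
    fun s => if s.2.2 = (![s.2.1.1, s.2.1.2.1, s.2.1.2.2] s.1).castSucc then 1 else 0

theorem eval_pencilPoly (k : Type) [CommRing k] (v : View) (j : Octet) (a : Fin 2) :
    MvPolynomial.eval (octetPoint k) (pencilPoly k v j a) =
      if a = ![j.1, j.2.1, j.2.2] v then 1 else 0 := by
  have h2 : a.castSucc ≠ (2 : Fin 3) := by
    revert a
    decide
  simp only [pencilPoly, map_sub, map_mul, MvPolynomial.eval_X, octetPoint, Sum.elim_inl,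
    Sum.elim_inr, if_neg h2, if_true, one_mul, mul_zero, sub_zero, Fin.castSucc_inj]

/-- At `octetPoint` every image point is (0, 0, 1) and the directions are the first two basis
vectors, chosen in each view by the label. The matrix becomes the identity. -/
theorem det_pencilMatrix_ne_zero (k : Type) [CommRing k] [Nontrivial k] :
    (pencilMatrix k).det ≠ 0 := by
  have h1 : (MvPolynomial.eval (octetPoint k)).mapMatrix (pencilMatrix k) = 1 := by
    ext ⟨j1, j2, j3⟩ ⟨c1, c2, c3⟩
    simp only [RingHom.mapMatrix_apply, Matrix.map_apply, pencilMatrix, Matrix.of_apply, map_mul,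
      eval_pencilPoly, Matrix.one_apply]
    simp only [Prod.mk.injEq, eq_comm (a := c1), eq_comm (a := c2), eq_comm (a := c3)]
    by_cases e1 : j1 = c1 <;> by_cases e2 : j2 = c2 <;> by_cases e3 : j3 = c3 <;>
      simp [e1, e2, e3]
  intro h0
  have := congrArg (MvPolynomial.eval (octetPoint k)) h0
  rw [RingHom.map_det, h1, det_one, map_zero] at this
  exact one_ne_zero this

/-- Eight triples of independent directions satisfy no trilinear relation. -/
theorem trilinear_eq_zero_of_independent {k : IntermediateField ℚ ℂ}
    {x : View → Fin 3 → ℂ} {u : View → Octet → Fin 3 → ℂ} {θ : OctetParam → ℂ}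
    (h : AlgebraicIndependent k θ) (hx : ∀ v a, θ (.inl (v, a)) = x v a)
    (hu : ∀ v j a, θ (.inr (v, j, a)) = u v j a) {T : Octet → ℂ}
    (hT : ∀ j, ∑ c, T c * (pencilCoord (x 0) (u 0 j) c.1 * pencilCoord (x 1) (u 1 j) c.2.1 *
      pencilCoord (x 2) (u 2 j) c.2.2) = 0) : T = 0 := by
  have hdet : ((MvPolynomial.aeval (R := k) θ).toRingHom.mapMatrix (pencilMatrix k)).det ≠ 0 := by
    rw [← RingHom.map_det]
    exact fun h0 => det_pencilMatrix_ne_zero k ((algebraicIndependent_iff.1 h) _ h0)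
  have hm (v : View) (j : Octet) (a : Fin 2) :
      MvPolynomial.aeval (R := k) θ (pencilPoly k v j a) = pencilCoord (x v) (u v j) a := by
    simp only [pencilPoly, map_sub, map_mul, MvPolynomial.aeval_X, hx, hu, pencilCoord]
  refine Matrix.eq_zero_of_mulVec_eq_zero hdet (funext fun j => ?_)
  rw [Pi.zero_apply, ← hT j, Matrix.mulVec, dotProduct]
  refine Finset.sum_congr rfl fun c _ => ?_
  rw [mul_comm, RingHom.mapMatrix_apply, Matrix.map_apply, pencilMatrix, Matrix.of_apply,
    AlgHom.toRingHom_eq_coe, RingHom.coe_coe, map_mul, map_mul, hm, hm, hm]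

namespace PointLineProblem

variable {ι κ : Type} {Q : PointLineProblem ι κ}

/-- Counting dimensions does not exclude eight pins: 3·(2+8) = 30 for the images and 11 + 3 + 8·2 =
30 for the scenes. The common trilinear relation does. -/
theorem IsDominant.ncard_pins_le [Finite ι] [Finite κ] (hPL1P : Q.IsPL1P) (h : Q.IsDominant)
    {i : ι} (hi : Q.viewsPt i = Set.univ) (hpins : ∀ j ∈ Q.pins i, Q.viewsLn j = Set.univ) :
    (Q.pins i).ncard ≤ 7 := by
  by_contra! hcard
  obtain ⟨e⟩ := nonempty_embedding_of_card_le_ncard (α := Octet) hcard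
  obtain ⟨k, θ, hθ, y, ⟨⟨A, P⟩, hsol⟩, hpt, hln⟩ := h.exists_solution hPL1P
  obtain ⟨w, hx, hu⟩ := exists_depth hPL1P hpt hln hsol hi hpins
  obtain ⟨T, hT0, hT⟩ := exists_trilinear_relation hsol.1.2 (x := fun v => paramPt θ v i)
    (w := w) (fun v => hθ.ne_zero (.inl (v, i, 2))) fun v => by
      rw [← hx v]
      exact Submodule.mem_span_singleton_self _
  let emb : OctetParam → ImageParam ι κ :=
    Sum.elim (fun s => .inl (s.1, i, s.2)) fun s => .inr (.inl (s.1, (e s.2.1 : κ), s.2.2))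
  have hemb : Function.Injective emb := by
    rintro (⟨v, a⟩ | ⟨v, j, a⟩) (⟨v', a'⟩ | ⟨v', j', a'⟩) hvv' <;>
      simp_all [emb, Subtype.val_injective.eq_iff]
  refine hT0 (trilinear_eq_zero_of_independent (hθ.comp emb hemb) (fun v a => rfl)
    (u := fun v j => paramDir θ v (e j)) (fun v j a => rfl) fun j => ?_)
  · obtain ⟨s, hs⟩ := hu (e j) (e j).2
    refine hT (fun v => paramDir θ v (e j)) s fun v => ?_
    rw [← hs v]
    exact Submodule.subset_span (by simp)

end PointLineProblem

/-! ### At most one point with three pins -/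

/-- Labels of the coordinates, in one view, of two points and of three directions through each. -/
abbrev PairParam : Type := Fin 2 × (Fin 3 ⊕ Fin 3 × Fin 3)

/-- Labels of numbers which determine the joint images of two points with three pins each: the first
image, the parameters of two rotations and two translations, the depths of the points and pins, and
the scalings in the other two images. -/
abbrev PairSolutionParam : Type :=
  PairParam ⊕ (Fin 2 × Fin 3) ⊕ Fin 2 ⊕ Fin 3 ⊕ Fin 2 ⊕ (Fin 2 × Fin 3) ⊕ (Fin 2 × Fin 2) ⊕
    (Fin 2 × Fin 2 × Fin 3 × Fin 2)

theorem mulVec_add_smul_mem {K : Subfield ℂ} {M : Matrix (Fin 3) (Fin 3) ℂ} {z t : Fin 3 → ℂ}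
    {s : ℂ} (hM : ∀ a b, M a b ∈ K) (hz : ∀ a, z a ∈ K) (hs : s ∈ K) (ht : ∀ a, t a ∈ K)
    (a : Fin 3) : (M *ᵥ z + s • t) a ∈ K := by
  rw [Pi.add_apply, Matrix.mulVec, dotProduct]
  exact K.add_mem (K.sum_mem fun b _ => K.mul_mem (hM a b) (hz b)) (K.mul_mem hs (ht a))

namespace PointLineProblem

variable {ι κ : Type} {Q : PointLineProblem ι κ}

/-- The joint image of two points with three pins each depends on too few parameters. -/
theorem IsDominant.eq_of_three_le_ncard_pins [Finite ι] [Finite κ] (hPL1P : Q.IsPL1P)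
    (h : Q.IsDominant) (i : Fin 2 → ι) (hpins : ∀ q, 3 ≤ (Q.pins (i q)).ncard)
    (hview : ∀ q, Q.viewsPt (i q) = Set.univ)
    (hview' : ∀ q, ∀ j ∈ Q.pins (i q), Q.viewsLn j = Set.univ) : i 0 = i 1 := by
  by_contra hne
  have hi : Function.Injective i := by
    intro q q' hqq'
    fin_cases q <;> fin_cases q'
    exacts [rfl, absurd hqq' hne, absurd hqq'.symm hne, rfl]
  have e (q) := nonempty_embedding_of_card_le_ncard (α := Fin 3) (s := Q.pins (i q))
    (by simpa using hpins q)
  replace e (q) := (e q).some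
  obtain ⟨k, θ, hθ, y, ⟨⟨A, P⟩, hsol⟩, hpt, hln⟩ := h.exists_solution hPL1P
  have hP := hsol.1.2
  choose w hx hu using fun q => exists_depth hPL1P hpt hln hsol (hview q) (hview' q)
  choose s hs using fun q t => hu q (e q t) (e q t).2
  choose r hr using fun v => exists_rotation_parameters (hP.1 v).1 (hP.1 v).2
  have hlam (q : Fin 2) (v : View) : ∃ c : ℂ, c • (rot (P v) *ᵥ paramPt θ 0 (i q) +
      w q • transl (P v)) = paramPt θ v (i q) := by
    rw [← Submodule.mem_span_singleton, hx]
    exact Submodule.mem_span_singleton_self _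
  have hab (q : Fin 2) (v : View) (t : Fin 3) : ∃ a b : ℂ,
      a • (rot (P v) *ᵥ paramPt θ 0 (i q) + w q • transl (P v)) +
      b • (rot (P v) *ᵥ paramDir θ 0 (e q t).1 + s q t • transl (P v)) =
        paramDir θ v (e q t).1 := by
    rw [← Submodule.mem_span_pair, hs]
    exact Submodule.subset_span (by simp)
  choose c hc using hlam
  choose α β hαβ using hab
  let emb : View × PairParam → ImageParam ι κ := fun s =>
    Sum.elim (fun a => .inl (s.1, i s.2.1, a))
      (fun ta => .inr (.inl (s.1, (e s.2.1 ta.1 : κ), ta.2))) s.2.2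
  have hemb : Function.Injective emb := by
    rintro ⟨v, q, a | ⟨t, a⟩⟩ ⟨v', q', a' | ⟨t', a'⟩⟩ hvv'
    · simp only [emb, Sum.elim_inl, Sum.inl.injEq, Prod.mk.injEq, hi.eq_iff] at hvv'
      simp [hvv']
    · simp [emb] at hvv'
    · simp [emb] at hvv'
    · simp only [emb, Sum.elim_inr, Sum.inr.injEq, Sum.inl.injEq, Prod.mk.injEq] at hvv'
      obtain ⟨rfl, h2, rfl⟩ := hvv'
      have hqq' : q = q' := by
        apply hi
        refine hPL1P _ (e q t).2 ?_
        rw [h2]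
        exact (e q' t').2
      subst hqq'
      obtain rfl := (e q).injective (Subtype.ext h2)
      rfl
  -- There are 24 + 6 + 2 + 3 + 2 + 6 + 4 + 24 = 71 generators for 3·24 = 72 independent numbers.
  -- The second camera contributes only two translation coordinates, as the first is normalized to
  -- 1; without this the count would be no contradiction.
  let b : PairSolutionParam → ℂ := Sum.elim (fun s => θ (emb (0, s)))
    (Sum.elim (fun s => r s.1.succ s.2) (Sum.elim (fun a => transl (P 1) a.succ)
    (Sum.elim (transl (P 2)) (Sum.elim w (Sum.elim (fun s' => s s'.1 s'.2)
    (Sum.elim (fun s => c s.1 s.2.succ)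
      fun s => ![α s.1 s.2.1.succ s.2.2.1, β s.1 s.2.1.succ s.2.2.1] s.2.2.2))))))
  let K := IntermediateField.adjoin k (Set.range b)
  have hb (s) : b s ∈ K.toSubfield := IntermediateField.subset_adjoin k _ ⟨s, rfl⟩
  have hx0 (q a) : paramPt θ 0 (i q) a ∈ K.toSubfield := hb (.inl (q, .inl a))
  have hu0 (q t a) : paramDir θ 0 (e q t).1 a ∈ K.toSubfield := hb (.inl (q, .inr (t, a)))
  have hR (v : Fin 2) (a a') : rot (P v.succ) a a' ∈ K.toSubfield :=
    hr v.succ K.toSubfield (fun a => hb (.inr (.inl (v, a)))) a a'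
  have ht (v : Fin 2) (a) : transl (P v.succ) a ∈ K.toSubfield := by
    fin_cases v
    · refine Fin.cases ?_ (fun a => ?_) a
      · have h1 : transl (P 1) 0 = 1 := hP.2.2.2
        change transl (P 1) 0 ∈ _
        rw [h1]
        exact K.toSubfield.one_mem
      · exact hb (.inr (.inr (.inl a)))
    · exact hb (.inr (.inr (.inr (.inl a))))
  have hw (q) : w q ∈ K.toSubfield := hb (.inr (.inr (.inr (.inr (.inl q)))))
  have hsK (q t) : s q t ∈ K.toSubfield := hb (.inr (.inr (.inr (.inr (.inr (.inl (q, t)))))))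
  have hcK (q) (v : Fin 2) : c q v.succ ∈ K.toSubfield :=
    hb (.inr (.inr (.inr (.inr (.inr (.inr (.inl (q, v))))))))
  have hαK (q) (v : Fin 2) (t) : α q v.succ t ∈ K.toSubfield :=
    hb (.inr (.inr (.inr (.inr (.inr (.inr (.inr (q, v, t, 0))))))))
  have hβK (q) (v : Fin 2) (t) : β q v.succ t ∈ K.toSubfield :=
    hb (.inr (.inr (.inr (.inr (.inr (.inr (.inr (q, v, t, 1))))))))
  have hX (q) (v : Fin 2) := mulVec_add_smul_mem (hR v) (hx0 q) (hw q) (ht v)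
  have hU (q t) (v : Fin 2) := mulVec_add_smul_mem (hR v) (hu0 q t) (hsK q t) (ht v)
  have hmem (s : View × PairParam) : (θ ∘ emb) s ∈ K := by
    obtain ⟨v, q, a | ⟨t, a⟩⟩ := s
    · change paramPt θ v (i q) a ∈ K.toSubfield
      refine Fin.cases (hx0 q a) (fun v => ?_) v
      rw [← hc]
      exact K.toSubfield.mul_mem (hcK q v) (hX q v a)
    · change paramDir θ v (e q t).1 a ∈ K.toSubfield
      refine Fin.cases (hu0 q t a) (fun v => ?_) v
      rw [← hαβ]
      exact K.toSubfield.add_mem (K.toSubfield.mul_mem (hαK q v t) (hX q v a))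
        (K.toSubfield.mul_mem (hβK q v t) (hU q t v a))
  have hcard := card_le_of_mem_adjoin (hθ.comp emb hemb) hmem
  simp at hcard

end PointLineProblem

end PointLine

theorem theorem5 (p l : ℕ) (Q : PointLine.PointLineProblem (Fin p) (Fin l))
    (hPL1P : Q.IsPL1P) (hreduced : Q.IsReduced) (hminimal : Q.IsCameraMinimal) :
    -- at most one point has three or more pins
    (∀ i i', 3 ≤ (Q.pins i).ncard → 3 ≤ (Q.pins i').ncard → i = i') ∧
    -- such a point has at most seven pins, and it is completely observed in all views
    (∀ i, 3 ≤ (Q.pins i).ncard →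
      (Q.pins i).ncard ≤ 7 ∧ Q.viewsPt i = Set.univ ∧ ∀ j ∈ Q.pins i, Q.viewsLn j = Set.univ) ∧
    -- points with two pins
    (∀ i j j', j ≠ j' → Q.pins i = {j, j'} →
      PointLine.TwoPinsTable (Q.viewsPt i) (Q.viewsLn j) (Q.viewsLn j') ∨
      PointLine.TwoPinsBothDangling (Q.viewsPt i) (Q.viewsLn j) (Q.viewsLn j') ∨
      PointLine.TwoPinsOneDangling (Q.viewsPt i) (Q.viewsLn j) (Q.viewsLn j') ∨
      PointLine.TwoPinsOneDangling (Q.viewsPt i) (Q.viewsLn j') (Q.viewsLn j)) ∧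
    -- points with one pin
    (∀ i j, Q.pins i = {j} →
      PointLine.OnePinTable (Q.viewsPt i) (Q.viewsLn j) ∨
      PointLine.OnePinDangling (Q.viewsPt i) (Q.viewsLn j)) ∧
    -- points without pins
    (∀ i, Q.pins i = ∅ → PointLine.ZeroPinsTable (Q.viewsPt i)) ∧
    -- free lines
    (∀ j, Q.IsFreeLine j → Q.viewsLn j = Set.univ) := by
  have hviews {i} (hi : 3 ≤ (Q.pins i).ncard) := hreduced.views_of_three_le hPL1P hi
  refine ⟨fun i i' hi hi' => ?_, fun i hi => ?_,
    fun i j j' => hreduced.twoPinsTable hPL1P, fun i j => hreduced.onePinTable hPL1P,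
    fun i => hreduced.zeroPinsTable hPL1P, fun j => hreduced.viewsLn_freeLine hPL1P⟩
  · refine hminimal.1.eq_of_three_le_ncard_pins hPL1P ![i, i'] ?_ ?_ ?_
    · exact Fin.forall_fin_two.2 ⟨hi, hi'⟩
    · exact Fin.forall_fin_two.2 ⟨(hviews hi).1, (hviews hi').1⟩
    · exact Fin.forall_fin_two.2 ⟨(hviews hi).2, (hviews hi').2⟩
  · exact ⟨hminimal.1.ncard_pins_le hPL1P (hviews hi).1 (hviews hi).2, hviews hi⟩
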